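/- Let $\hat K=[0,1]^2$, let $r\ge 0$ be an integer and let $\hat V$ be a finite-dimensional space of real polynomials in two variables containing $\mathcal P_r$, the polynomials of total degree at most $r$. An element is $K=F(\hat K)$, a convex quadrilateral (with four strict corners), where $F$ is a bilinear isomorphism of $\hat K$ onto $K$ (a map affine in each coordinate that sends the corners of $\hat K$ to the vertices of $K$ in cyclic order). Put $V_F(K)=\{u:\ u\circ F\in\hat V\}$ and $h_K=\operatorname{diam}K$. Let $\sigma_K=\max(|\pi-\theta_1|,|\pi-\theta_2|)$, where $\theta_1$ and $\theta_2$ are the angles between the outward normals of the two pairs of opposite sides of $K$. Given constants $\kappa$, $\gamma<1$ and $M$, call $K$ shape-regular if $h_K\le\kappa\,\ell$ for each side length $\ell$ of $K$ and $|\cos\theta|\le\gamma$ for each interior angle $\theta$ of $K$, and call it asymptotically parallelogram if $\sigma_K\le M h_K$. $H^{m}(K)$ carries its full norm. Call a linear operator $\hat\pi:H^{r+1}(\hat K)\to\hat V$ a reference operator if $\|\hat\pi w\|_{L^2(\hat K)}\le B\|w\|_{H^{r+1}(\hat K)}$ for some constant $B$ and all $w$, and $\hat\pi q=q$ for all $q\in\mathcal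 P_r$. It induces $\pi v=(\hat\pi(v\circ F))\circ F^{-1}$ on each element $K$. Then: 1. There is a constant $C$, depending only on $\kappa,\gamma,M$, such that $|F|_{W^2_\infty(\hat K)}\le C h_K^2$ for every shape-regular, asymptotically parallelogram element $K=F(\hat K)$. 2. Reference operators exist, and for every reference operator $\hat\pi$ there is a constant $C$, depending only on $r,\hat V,\hat\pi,\kappa,\gamma,M$, such that for every shape-regular, asymptotically parallelogram element $K$ and every $v\in H^{r+1}(K)$ $$\|v-\pi v\|_{L^2(K)}\le C\,h_K^{r+1}\,\|v\|_{H^{r+1}(K)} .$$ 3. There is a constant $C$, depending only on $r,\hat V,\kappa,\gamma,M$, such that for every open set $\Omega\subset\mathbb R^2$, every mesh $\mathcal T$ of $\Omega$ by finitely many such elements (their union is $\overline\Omega$, and their interiors lie in $\Omega$ and are pairwise disjoint), with $h=\max_{K\in\mathcal T}h_K$, and every $u\in H^{r+1}(\Omega)$ $$\inf_{w\in V^{\mathcal T}}\|u-w\|_{L^2(\Omega)}\le C\,h^{r+1}\,\|u\|_{H^{r+1}(\Omega)},$$ where $V^{\mathcal T}$ is the space of functions whose restriction to each $K=F_K(\hat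 K)\in\mathcal T$ belongs to $V_{F_K}(K)$ (no interelement continuity is imposed). -/

import Mathlib

open MeasureTheory
open scoped ENNReal ContDiff

noncomputable section

namespace QuadFE

/-- The Euclidean plane. -/
abbrev Plane : Type := EuclideanSpace ℝ (Fin 2)

/-! ### Sobolev spaces on open subsets of the plane -/

/-- The classical partial derivative in the `i`-th coordinate. -/
def partialDeriv {E : Type*} [NormedAddCommGroup E] [NormedSpace ℝ E]
    (i : Fin 2) (f : Plane → E) (x : Plane) : E :=
  fderiv ℝ f x (EuclideanSpace.single i (1 : ℝ))

/-- The classical derivative with multi-index `α = (α₁, α₂)`. -/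
def multiDeriv (α : ℕ × ℕ) (f : Plane → ℝ) : Plane → ℝ :=
  (partialDeriv 0)^[α.1] ((partialDeriv 1)^[α.2] f)

/-- `g` is the weak derivative of `v` with multi-index `α` on the open set `U`
(used for `v` and `g` square integrable on `U`). -/
def HasWeakDeriv (U : Set Plane) (α : ℕ × ℕ) (v g : Plane → ℝ) : Prop :=
  ∀ φ : Plane → ℝ, ContDiff ℝ ∞ φ → HasCompactSupport φ → tsupport φ ⊆ U →
    ∫ x in U, v x * multiDeriv α φ x = (-1) ^ (α.1 + α.2) * ∫ x in U, g x * φ x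

/-- `v ∈ H^m(U)`: `v` and its weak derivatives of order at most `m` are square integrable. -/
def MemSobolev (m : ℕ) (U : Set Plane) (v : Plane → ℝ) : Prop :=
  MemLp v 2 (volume.restrict U) ∧
    ∀ α : ℕ × ℕ, α.1 + α.2 ≤ m →
      ∃ g : Plane → ℝ, MemLp g 2 (volume.restrict U) ∧ HasWeakDeriv U α v g

open Classical in
/-- The square integrable weak derivative with multi-index `α` (unique almost everywhere on `U`),
and `0` if there is none. -/
def weakDeriv (U : Set Plane) (α : ℕ × ℕ) (v : Plane → ℝ) : Plane → ℝ :=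
  if h : ∃ g : Plane → ℝ, MemLp g 2 (volume.restrict U) ∧ HasWeakDeriv U α v g
  then h.choose else 0

/-- The full norm of `H^m(U)`, for `v` with `MemSobolev m U v`:
the square root of the sum of `‖∂^α v‖²` in `L²(U)` over all `|α| ≤ m`. -/
def sobolevNorm (m : ℕ) (U : Set Plane) (v : Plane → ℝ) : ℝ≥0∞ :=
  (∑ k ∈ Finset.range (m + 1), ∑ α ∈ Finset.HasAntidiagonal.antidiagonal k,
    eLpNorm (weakDeriv U α v) 2 (volume.restrict U) ^ 2) ^ (1 / 2 : ℝ)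

/-! ### Bilinear maps of the unit square onto convex quadrilaterals -/

/-- The closed unit square, the reference element. -/
def unitSquare : Set Plane := {x | ∀ i, x i ∈ Set.Icc (0 : ℝ) 1}

/-- The map of the plane, affine in each coordinate separately, that takes the corners
`(0,0), (1,0), (1,1), (0,1)` to `p 0, p 1, p 2, p 3`. Every bilinear map has this form for
exactly one `p`, so the labelled vertices `p` stand for the map and for the quadrilateral. -/
def bilinearMap (p : Fin 4 → Plane) (x : Plane) : Plane :=
  ((1 - x 0) * (1 - x 1)) • p 0 + (x 0 * (1 - x 1)) • p 1 + (x 0 * x 1) • p 2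
    + ((1 - x 0) * x 1) • p 3

/-- The element `K = F(unit square)`. -/
def element (p : Fin 4 → Plane) : Set Plane := bilinearMap p '' unitSquare

/-- The element diameter `h_K`. -/
def elementDiam (p : Fin 4 → Plane) : ℝ := Metric.diam (element p)

/-- The planar cross product. -/
def cross (a b : Plane) : ℝ := a 0 * b 1 - a 1 * b 0

/-- The side vector from vertex `i` to the next vertex (indices modulo 4). -/
def side (p : Fin 4 → Plane) (i : Fin 4) : Plane := p (i + 1) - p i

/-- `p 0, p 1, p 2, p 3` are, in this cyclic order, the vertices of a (nondegenerate) convex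
quadrilateral: the boundary turns strictly to the left at each vertex, or strictly to the right
at each vertex. Equivalently `bilinearMap p` is an isomorphism of the unit square onto
a convex quadrilateral (the cross products are its Jacobian determinants at the corners). -/
def IsConvexQuad (p : Fin 4 → Plane) : Prop :=
  (∀ i, 0 < cross (side p i) (side p (i + 1))) ∨ (∀ i, cross (side p i) (side p (i + 1)) < 0)

/-- Under `IsConvexQuad p` the bilinear map is one-to-one on the unit square. -/
theorem IsConvexQuad.injOn {p : Fin 4 → Plane} (hp : IsConvexQuad p) :
    Set.InjOn (bilinearMap p) unitSquare := by
  intro x hx y hy h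
  have h0 := congrArg (fun z : Plane => z 0) h
  have h1 := congrArg (fun z : Plane => z 1) h
  simp only [bilinearMap, PiLp.add_apply, PiLp.smul_apply, smul_eq_mul] at h0 h1
  have hx0 := hx 0
  have hx1 := hx 1
  have hy0 := hy 0
  have hy1 := hy 1
  obtain ⟨s, hs⟩ : ∃ s, s = (x 0 + y 0) / 2 := ⟨_, rfl⟩
  obtain ⟨t, ht⟩ : ∃ t, t = (x 1 + y 1) / 2 := ⟨_, rfl⟩
  have hs0 : 0 ≤ s := by linarith [hx0.1, hy0.1]
  have hs1 : 0 ≤ 1 - s := by linarith [hx0.2, hy0.2]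
  have ht0 : 0 ≤ t := by linarith [hx1.1, hy1.1]
  have ht1 : 0 ≤ 1 - t := by linarith [hx1.2, hy1.2]
  -- the Jacobian determinant at the midpoint of `x` and `y`
  obtain ⟨J, hJ⟩ : ∃ J, J = (1 - s) * (1 - t) * cross (side p 3) (side p 0)
    + s * (1 - t) * cross (side p 0) (side p 1) + s * t * cross (side p 1) (side p 2)
    + (1 - s) * t * cross (side p 2) (side p 3) := ⟨_, rfl⟩
  have key : ∀ c : Fin 4 → ℝ, (∀ i, 0 < c i) →
      0 < (1 - s) * (1 - t) * c 3 + s * (1 - t) * c 0 + s * t * c 1 + (1 - s) * t * c 2 := by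
    intro c hc
    obtain ⟨δ, hδ, hδc⟩ : ∃ δ, 0 < δ ∧ ∀ i, δ ≤ c i := by
      refine ⟨min (min (c 0) (c 1)) (min (c 2) (c 3)), by simp [hc], ?_⟩
      intro i
      fin_cases i <;> simp
    have a1 := mul_le_mul_of_nonneg_left (hδc 3) (mul_nonneg hs1 ht1)
    have a2 := mul_le_mul_of_nonneg_left (hδc 0) (mul_nonneg hs0 ht1)
    have a3 := mul_le_mul_of_nonneg_left (hδc 1) (mul_nonneg hs0 ht0)
    have a4 := mul_le_mul_of_nonneg_left (hδc 2) (mul_nonneg hs1 ht0)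
    nlinarith
  have hJ0 : J ≠ 0 := by
    rcases hp with hp | hp
    · have := key (fun i => cross (side p i) (side p (i + 1))) hp
      exact (this.trans_eq hJ.symm).ne'
    · have := key (fun i => -cross (side p i) (side p (i + 1))) (fun i => by simpa using hp i)
      have e : J = -((1 - s) * (1 - t) * -cross (side p 3) (side p 0)
        + s * (1 - t) * -cross (side p 0) (side p 1) + s * t * -cross (side p 1) (side p 2)
        + (1 - s) * t * -cross (side p 2) (side p 3)) := by rw [hJ]; ring
      exact (e.trans_lt (neg_neg_of_pos this)).ne
  have e30 : (3 : Fin 4) + 1 = 0 := rfl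
  have e01 : (0 : Fin 4) + 1 = 1 := rfl
  have e12 : (1 : Fin 4) + 1 = 2 := rfl
  have e23 : (2 : Fin 4) + 1 = 3 := rfl
  have d0 : (x 0 - y 0) * J = 0 := by
    rw [hJ]
    simp only [cross, side, PiLp.sub_apply, e30, e01, e12, e23]
    subst hs ht
    linear_combination
      ((1 - (x 0 + y 0) / 2) * (p 3 1 - p 0 1) + (x 0 + y 0) / 2 * (p 2 1 - p 1 1)) * h0
      - ((1 - (x 0 + y 0) / 2) * (p 3 0 - p 0 0) + (x 0 + y 0) / 2 * (p 2 0 - p 1 0)) * h1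
  have d1 : (x 1 - y 1) * J = 0 := by
    rw [hJ]
    simp only [cross, side, PiLp.sub_apply, e30, e01, e12, e23]
    subst hs ht
    linear_combination
      ((1 - (x 1 + y 1) / 2) * (p 1 0 - p 0 0) + (x 1 + y 1) / 2 * (p 2 0 - p 3 0)) * h1
      - ((1 - (x 1 + y 1) / 2) * (p 1 1 - p 0 1) + (x 1 + y 1) / 2 * (p 2 1 - p 3 1)) * h0
  have f0 := (mul_eq_zero.1 d0).resolve_right hJ0
  have f1 := (mul_eq_zero.1 d1).resolve_right hJ0
  ext i
  fin_cases i
  · exact sub_eq_zero.1 f0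
  · exact sub_eq_zero.1 f1

/-- Shape regularity with constants `κ` and `γ < 1`: the ratio of the diameter to each
side length is at most `κ`, and the interior angles `θ` satisfy `|cos θ| ≤ γ`. -/
def ShapeRegular (κ γ : ℝ) (p : Fin 4 → Plane) : Prop :=
  ∀ i, elementDiam p ≤ κ * ‖side p i‖ ∧
    |Real.cos (EuclideanGeometry.angle (p (i - 1)) (p i) (p (i + 1)))| ≤ γ

/-- The outward normal (not normalised) to the side from vertex `i` to vertex `i + 1`: the side
vector turned by a right angle, clockwise if the vertices run counterclockwise. -/
def outwardNormal (p : Fin 4 → Plane) (i : Fin 4) : Plane :=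
  Real.sign (cross (side p i) (side p (i + 1))) • !₂[side p i 1, -side p i 0]

/-- The angle between the outward normals of side `i` and the opposite side. -/
def normalAngle (p : Fin 4 → Plane) (i : Fin 4) : ℝ :=
  InnerProductGeometry.angle (outwardNormal p i) (outwardNormal p (i + 2))

/-- The deviation `σ_K` of a quadrilateral from a parallelogram. -/
def sigma (p : Fin 4 → Plane) : ℝ :=
  max |Real.pi - normalAngle p 0| |Real.pi - normalAngle p 1|

/-- The seminorm of `W^2_∞` on the unit square, for a smooth map: the supremum
of the second order partial derivatives. -/
def w2infSeminorm (F : Plane → Plane) : ℝ≥0∞ :=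
  ⨆ x ∈ unitSquare, ⨆ i : Fin 2, ⨆ j : Fin 2, ‖partialDeriv i (partialDeriv j F) x‖ₑ

/-! ### Mapped spaces, projections and meshes -/

/-- The function on the plane given by a polynomial in two variables. -/
def polyFun (q : MvPolynomial (Fin 2) ℝ) (x : Plane) : ℝ := MvPolynomial.eval (fun i => x i) q

/-- `u ∈ V_F(K)`: the pullback `u ∘ F` agrees almost everywhere on the unit square
with an element of the reference space. -/
def MemMapped (V : Submodule ℝ (MvPolynomial (Fin 2) ℝ)) (p : Fin 4 → Plane)
    (u : Plane → ℝ) : Prop :=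
  ∃ q ∈ V, (fun x => u (bilinearMap p x)) =ᵐ[volume.restrict unitSquare] polyFun q

/-- `T` is a bounded linear operator from `H^{r+1}` of the unit square into the reference space
`V` that reproduces the polynomials of total degree at most `r`. -/
structure IsReferenceOperator (r : ℕ) (V : Submodule ℝ (MvPolynomial (Fin 2) ℝ))
    (T : (Plane → ℝ) → MvPolynomial (Fin 2) ℝ) : Prop where
  mem : ∀ w, MemSobolev (r + 1) (interior unitSquare) w → T w ∈ V
  map_add : ∀ w w', MemSobolev (r + 1) (interior unitSquare) w →
    MemSobolev (r + 1) (interior unitSquare) w' → T (w + w') = T w + T w'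
  map_smul : ∀ (c : ℝ) w, MemSobolev (r + 1) (interior unitSquare) w → T (c • w) = c • T w
  bounded : ∃ B : ℝ, ∀ w, MemSobolev (r + 1) (interior unitSquare) w →
    eLpNorm (polyFun (T w)) 2 (volume.restrict unitSquare)
      ≤ ENNReal.ofReal B * sobolevNorm (r + 1) (interior unitSquare) w
  reproduces : ∀ q ∈ MvPolynomial.restrictTotalDegree (Fin 2) ℝ r, T (polyFun q) = q

/-- The operator on the element `K` induced by the reference operator `T`:
`π v = (T (v ∘ F)) ∘ F⁻¹`. -/
def elementOperator (T : (Plane → ℝ) → MvPolynomial (Fin 2) ℝ) (p : Fin 4 → Plane)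
    (v : Plane → ℝ) (y : Plane) : ℝ :=
  polyFun (T (fun x => v (bilinearMap p x))) (Function.invFunOn (bilinearMap p) unitSquare y)

/-- A mesh of an open set of the plane by finitely many convex quadrilaterals with disjoint
interiors, each with a chosen bilinear map from the unit square (the labelling of its vertices). -/
structure QuadMesh where
  domain : Set Plane
  isOpen_domain : IsOpen domain
  elements : Finset (Fin 4 → Plane)
  convex : ∀ p ∈ elements, IsConvexQuad p
  interior_subset : ∀ p ∈ elements, interior (element p) ⊆ domain
  cover : ⋃ p ∈ elements, element p = closure domain
  disjoint : ∀ p ∈ elements, ∀ q ∈ elements, p ≠ q →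
    Disjoint (interior (element p)) (interior (element q))

/-- The mesh size, the largest element diameter. -/
def QuadMesh.size (𝒯 : QuadMesh) : ℝ := ⨆ p : 𝒯.elements, elementDiam p.1

/-- The finite element space without interelement continuity: the functions whose restriction
to each element `K` belongs to `V_F(K)`. -/
def QuadMesh.space (𝒯 : QuadMesh) (V : Submodule ℝ (MvPolynomial (Fin 2) ℝ)) :
    Set (Plane → ℝ) :=
  {w | ∀ p ∈ 𝒯.elements, MemMapped V p w}

end QuadFE

end

open QuadFE

/-!
The bilinear map `F` of a quadrilateral has a single nonvanishing second derivative, the constant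
mixed one, here called the twist: minus the sum of two opposite side vectors. The angle between the
normals of two opposite sides is close to `π` exactly when these sides are nearly antiparallel, so
`σ_K ≤ M h` bounds the cross product of the twist with each of two adjacent sides by `M h` times a
product of two sides. Two adjacent sides are uniformly transversal by shape regularity, so the
twist is of order `h ^ 2` (`norm_twist_le`). The same transversality bounds the Jacobian
determinant, a bilinear interpolant of its corner values, below by a multiple of `h ^ 2`
(`ShapeRegular.le_abs_jac`); it is at most `h ^ 2` on every element (`abs_jac_le`).

The error on an element is estimated on the unit square. Since the first derivatives of `F` are of
order `h` and the second ones of order `h ^ 2`, the chain rule shows that every derivative of order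
`l` of `v ∘ F` is of order `h ^ l`, when measured by the full Sobolev norm of `v`
(`IsConvexQuad.weakBound_pullback`). The chain rule for weak derivatives
(`IsConvexQuad.weakPartial_comp`) is proved by duality, moving test functions to the element by the
Piola transform, so that no approximation by smooth functions is needed. An iterated weak
derivative is handled as a tree of first order ones (`WeakBound`), which the induction over the
order follows; `WeakBound.exists_hasWeakDeriv` and `MemSobolev.weakBound` pass to multi-indices and
back.

The Bramble–Hilbert lemma on the square (`bramble_hilbert`) says that, modulo polynomials of degree
at most `r`, the norm of order `r + 1` is controlled by the derivatives of order `r + 1` alone. It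
follows from the Poincaré inequality by removing the mean values of the derivatives of highest
order and descending (`IsJet.exists_polynomial`). The Poincaré inequality (`poincare_unitSquare`)
is dual to an explicit compactly supported right inverse of the divergence
(`exists_divergence_eq`), built from primitives along the coordinate lines. A reference operator is
bounded and preserves these polynomials, so its error on `v ∘ F` is of order `h ^ (r + 1)`; the
factor `h⁻¹` from the change of variables for `v ∘ F` cancels against the factor `h` from that for
the error (`IsReferenceOperator.exists_element_estimate`). The `L²` projection onto `V` is a
reference operator (`isReferenceOperator_l2Projection`).

On a mesh, the elementwise projections form an element of the mapped space. The squares of the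
element errors add up, because the boundaries of the elements are null sets, and the squares of the
Sobolev norms over the disjoint interiors sum to at most the square of the norm over the domain
(`MemSobolev.sum_sobolevNorm_sq_le`).
-/

/-! ### Geometry of convex quadrilaterals -/

namespace QuadFE

/-- The partial derivatives of the bilinear map: `tangent p j x` is `∂ⱼF(x)`. -/
noncomputable def tangent (p : Fin 4 → Plane) (j : Fin 2) (x : Plane) : Plane :=
  if j = 0 then (1 - x 1) • side p 0 - x 1 • side p 2
  else x 0 • side p 1 - (1 - x 0) • side p 3

/-- The mixed second derivative of the bilinear map, a constant vector. -/
noncomputable def twist (p : Fin 4 → Plane) : Plane := -(side p 0 + side p 2)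

/-- The Jacobian determinant of the bilinear map. -/
noncomputable def jac (p : Fin 4 → Plane) (x : Plane) : ℝ :=
  cross (tangent p 0 x) (tangent p 1 x)

theorem side_zero (p : Fin 4 → Plane) : side p 0 = p 1 - p 0 := rfl
theorem side_one (p : Fin 4 → Plane) : side p 1 = p 2 - p 1 := rfl
theorem side_two (p : Fin 4 → Plane) : side p 2 = p 3 - p 2 := rfl
theorem side_three (p : Fin 4 → Plane) : side p 3 = p 0 - p 3 := rfl

/-- The derivative of the bilinear map, as a continuous linear map. -/
noncomputable def bilinearDeriv (p : Fin 4 → Plane) (x : Plane) : Plane →L[ℝ] Plane :=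
  (EuclideanSpace.proj (𝕜 := ℝ) (0 : Fin 2)).smulRight (tangent p 0 x)
    + (EuclideanSpace.proj (𝕜 := ℝ) (1 : Fin 2)).smulRight (tangent p 1 x)

theorem hasFDerivAt_bilinearMap (p : Fin 4 → Plane) (x : Plane) :
    HasFDerivAt (bilinearMap p) (bilinearDeriv p x) x := by
  have h0 : HasFDerivAt (fun x : Plane => x 0) (EuclideanSpace.proj (𝕜 := ℝ) (0 : Fin 2)) x :=
    (EuclideanSpace.proj (𝕜 := ℝ) (0 : Fin 2)).hasFDerivAt
  have h1 : HasFDerivAt (fun x : Plane => x 1) (EuclideanSpace.proj (𝕜 := ℝ) (1 : Fin 2)) x :=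
    (EuclideanSpace.proj (𝕜 := ℝ) (1 : Fin 2)).hasFDerivAt
  have := (((((h0.const_sub 1).mul (h1.const_sub 1)).smul_const (p 0)).add
    ((h0.mul (h1.const_sub 1)).smul_const (p 1))).add ((h0.mul h1).smul_const (p 2))).add
    (((h0.const_sub 1).mul h1).smul_const (p 3))
  refine this.congr_fderiv ?_
  ext z i
  simp [bilinearDeriv, tangent, side_zero, side_one, side_two, side_three]
  ring

theorem contDiff_bilinearMap (p : Fin 4 → Plane) : ContDiff ℝ ∞ (bilinearMap p) := by
  unfold bilinearMap
  fun_prop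

theorem contDiff_tangent (p : Fin 4 → Plane) (j : Fin 2) : ContDiff ℝ ∞ (tangent p j) := by
  unfold tangent
  split_ifs <;> fun_prop

theorem partialDeriv_bilinearMap (p : Fin 4 → Plane) (j : Fin 2) :
    partialDeriv j (bilinearMap p) = tangent p j := by
  ext x i
  rw [partialDeriv, (hasFDerivAt_bilinearMap p x).fderiv]
  fin_cases j <;> simp [bilinearDeriv]

theorem hasFDerivAt_tangent (p : Fin 4 → Plane) (j : Fin 2) (x : Plane) :
    HasFDerivAt (tangent p j)
      ((EuclideanSpace.proj (𝕜 := ℝ) (1 - j : Fin 2)).smulRight (twist p)) x := by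
  have h (i : Fin 2) : HasFDerivAt (fun x : Plane => x i) (EuclideanSpace.proj (𝕜 := ℝ) i) x :=
    (EuclideanSpace.proj (𝕜 := ℝ) i).hasFDerivAt
  fin_cases j
  · have := (((h 1).const_sub 1).smul_const (side p 0)).sub ((h 1).smul_const (side p 2))
    refine this.congr_fderiv ?_
    ext z i
    simp [twist, side_zero, side_two]
    ring
  · have := ((h 0).smul_const (side p 1)).sub (((h 0).const_sub 1).smul_const (side p 3))
    refine this.congr_fderiv ?_
    ext z i
    simp [twist, side_zero, side_one, side_two, side_three]
    ring

theorem partialDeriv_tangent (p : Fin 4 → Plane) (i j : Fin 2) (x : Plane) :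
    partialDeriv i (tangent p j) x = if i = j then 0 else twist p := by
  rw [partialDeriv, (hasFDerivAt_tangent p j x).fderiv]
  fin_cases i <;> fin_cases j <;> simp

theorem det_fderiv_bilinearMap (p : Fin 4 → Plane) (x : Plane) :
    (bilinearDeriv p x).det = jac p x := by
  rw [bilinearDeriv, ContinuousLinearMap.det,
    ← LinearMap.det_toMatrix (EuclideanSpace.basisFun (Fin 2) ℝ).toBasis, Matrix.det_fin_two]
  simp [LinearMap.toMatrix_apply, jac, cross]
  ring

/-- The Jacobian determinant is the bilinear interpolant of its corner values. -/
theorem jac_eq (p : Fin 4 → Plane) (x : Plane) :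
    jac p x = (1 - x 0) * (1 - x 1) * cross (side p 3) (side p 0)
      + x 0 * (1 - x 1) * cross (side p 0) (side p 1) + x 0 * x 1 * cross (side p 1) (side p 2)
      + (1 - x 0) * x 1 * cross (side p 2) (side p 3) := by
  simp [jac, cross, tangent, side_zero, side_one, side_two, side_three]
  ring

theorem isCompact_unitSquare : IsCompact unitSquare := by
  have : unitSquare = (WithLp.toLp 2) '' (Set.Icc (0 : Fin 2 → ℝ) 1) := by
    ext x
    simp only [unitSquare, Set.mem_ofPred_eq, Set.mem_Icc, Set.mem_image, Pi.le_def]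
    constructor
    · intro h
      exact ⟨x.ofLp, ⟨fun i => (h i).1, fun i => (h i).2⟩, rfl⟩
    · rintro ⟨y, hy, rfl⟩ i
      exact ⟨hy.1 i, hy.2 i⟩
  rw [this]
  exact isCompact_Icc.image (PiLp.continuous_toLp 2 _)

theorem interior_unitSquare : interior unitSquare = {x | ∀ i, x i ∈ Set.Ioo (0 : ℝ) 1} := by
  have : unitSquare = (EuclideanSpace.equiv (Fin 2) ℝ).toHomeomorph ⁻¹'
      (Set.univ.pi fun _ => Set.Icc (0 : ℝ) 1) := by
    ext x
    simp only [unitSquare, Set.mem_ofPred_eq, Set.mem_preimage, Set.mem_univ_pi]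
    rfl
  rw [this, ← Homeomorph.preimage_interior, interior_pi_set Set.finite_univ]
  ext x
  simp

theorem isCompact_element (p : Fin 4 → Plane) : IsCompact (element p) :=
  isCompact_unitSquare.image (contDiff_bilinearMap p).continuous

theorem vertex_mem_element (p : Fin 4 → Plane) (i : Fin 4) : p i ∈ element p := by
  fin_cases i
  · exact ⟨!₂[0, 0], fun i => by fin_cases i <;> simp, by simp [bilinearMap]⟩
  · exact ⟨!₂[1, 0], fun i => by fin_cases i <;> simp, by simp [bilinearMap]⟩
  · exact ⟨!₂[1, 1], fun i => by fin_cases i <;> simp, by simp [bilinearMap]⟩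
  · exact ⟨!₂[0, 1], fun i => by fin_cases i <;> simp, by simp [bilinearMap]⟩

theorem norm_side_le (p : Fin 4 → Plane) (i : Fin 4) : ‖side p i‖ ≤ elementDiam p := by
  rw [side, ← dist_eq_norm]
  exact Metric.dist_le_diam_of_mem (isCompact_element p).isBounded
    (vertex_mem_element p _) (vertex_mem_element p _)

theorem elementDiam_nonneg (p : Fin 4 → Plane) : 0 ≤ elementDiam p := Metric.diam_nonneg

theorem IsConvexQuad.side_ne_zero {p : Fin 4 → Plane} (hp : IsConvexQuad p) (i : Fin 4) :
    side p i ≠ 0 := by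
  intro h
  rcases hp with hp | hp <;> simpa [h, cross] using hp i

theorem IsConvexQuad.elementDiam_pos {p : Fin 4 → Plane} (hp : IsConvexQuad p) :
    0 < elementDiam p :=
  (norm_pos_iff.2 (hp.side_ne_zero 0)).trans_le (norm_side_le p 0)

theorem norm_sq_eq_sum_sq (a : Plane) : ‖a‖ ^ 2 = a 0 ^ 2 + a 1 ^ 2 := by
  simp [EuclideanSpace.real_norm_sq_eq]

theorem inner_eq_sum_mul (a b : Plane) : inner ℝ a b = a 0 * b 0 + a 1 * b 1 := by
  simp [PiLp.inner_apply, mul_comm]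

/-- Lagrange's identity in the plane. -/
theorem cross_sq_add_inner_sq (a b : Plane) :
    cross a b ^ 2 + inner ℝ a b ^ 2 = (‖a‖ * ‖b‖) ^ 2 := by
  rw [mul_pow, norm_sq_eq_sum_sq, norm_sq_eq_sum_sq, inner_eq_sum_mul, cross]
  ring

theorem abs_cross_le (a b : Plane) : |cross a b| ≤ ‖a‖ * ‖b‖ := by
  refine abs_le_of_sq_le_sq ?_ (by positivity)
  nlinarith [cross_sq_add_inner_sq a b]

theorem abs_cross_eq (a b : Plane) :
    |cross a b| = ‖a‖ * ‖b‖ * Real.sin (InnerProductGeometry.angle a b) := by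
  have h := InnerProductGeometry.sin_angle_mul_norm_mul_norm a b
  rw [mul_comm, h, ← Real.sqrt_sq_eq_abs]
  congr 1
  rw [real_inner_self_eq_norm_sq, real_inner_self_eq_norm_sq]
  nlinarith [cross_sq_add_inner_sq a b]

/-- A lower bound for the parallelogram spanned by two vectors at an angle away from `0` and `π`. -/
theorem le_abs_cross_of_abs_cos_le {a b : Plane} {γ : ℝ}
    (h : |Real.cos (InnerProductGeometry.angle a b)| ≤ γ) :
    √(1 - γ ^ 2) * (‖a‖ * ‖b‖) ≤ |cross a b| := by
  rw [abs_cross_eq, mul_comm]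
  refine mul_le_mul_of_nonneg_left ?_ (by positivity)
  rw [← Real.sqrt_sq (InnerProductGeometry.sin_angle_nonneg a b)]
  apply Real.sqrt_le_sqrt
  have := sq_le_sq' (abs_le.1 h).1 (abs_le.1 h).2
  nlinarith [Real.sin_sq_add_cos_sq (InnerProductGeometry.angle a b)]

theorem ShapeRegular.le_abs_cross_side {κ γ : ℝ} {p : Fin 4 → Plane} (h : ShapeRegular κ γ p)
    (i : Fin 4) :
    √(1 - γ ^ 2) * (‖side p i‖ * ‖side p (i + 1)‖) ≤ |cross (side p i) (side p (i + 1))| := by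
  have h1 := (h (i + 1)).2
  rw [EuclideanGeometry.angle] at h1
  have h2 := le_abs_cross_of_abs_cos_le h1
  have e1 : p (i + 1 - 1) -ᵥ p (i + 1) = -side p i := by simp [side]
  have e2 : p (i + 1 + 1) -ᵥ p (i + 1) = side p (i + 1) := by simp [side]
  rw [e1, e2, norm_neg] at h2
  refine h2.trans_eq ?_
  rw [← abs_neg]
  congr 1
  simp [cross]
  ring

/-- The deviation of the angle of two outward normals from `π` bounds the cross product of the
two opposite sides. -/
theorem IsConvexQuad.abs_cross_opposite_le {p : Fin 4 → Plane} (hp : IsConvexQuad p) (i : Fin 4) :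
    |cross (side p i) (side p (i + 2))|
      ≤ ‖side p i‖ * ‖side p (i + 2)‖ * |Real.pi - normalAngle p i| := by
  have key : ∀ s : ℝ, s ^ 2 = 1 →
      (∀ i, Real.sign (cross (side p i) (side p (i + 1))) = s) →
      InnerProductGeometry.angle (side p i) (side p (i + 2)) = normalAngle p i := by
    intro s hs h
    have hn : ∀ a : Plane, ‖s • !₂[a 1, -a 0]‖ = ‖a‖ := by
      intro a
      rw [← sq_eq_sq₀ (norm_nonneg _) (norm_nonneg _), norm_sq_eq_sum_sq, norm_sq_eq_sum_sq]
      simp [mul_pow, hs]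
      ring
    rw [normalAngle, outwardNormal, outwardNormal, h, h, InnerProductGeometry.angle,
      InnerProductGeometry.angle, hn, hn]
    congr 2
    rw [inner_eq_sum_mul, inner_eq_sum_mul]
    simp
    linear_combination (-(side p i 0 * side p (i + 2) 0 + side p i 1 * side p (i + 2) 1)) * hs
  have key' : InnerProductGeometry.angle (side p i) (side p (i + 2)) = normalAngle p i := by
    rcases hp with hp | hp
    · exact key 1 (by norm_num) fun i => Real.sign_of_pos (hp i)
    · exact key (-1) (by norm_num) fun i => Real.sign_of_neg (hp i)
  rw [abs_cross_eq, key']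
  refine mul_le_mul_of_nonneg_left ?_ (by positivity)
  rw [← Real.sin_pi_sub]
  refine (le_abs_self _).trans ?_
  exact Real.abs_sin_le_abs

/-- The twist is of second order in the diameter: it is nearly parallel to two directions
that span the plane. -/
theorem norm_twist_le {γ M : ℝ} (hγ : γ < 1) {κ : ℝ} {p : Fin 4 → Plane} (hp : IsConvexQuad p)
    (hs : ShapeRegular κ γ p) (hM : sigma p ≤ M * elementDiam p) :
    ‖twist p‖ ≤ 2 * M / √(1 - γ ^ 2) * elementDiam p ^ 2 := by
  have hγ0 : 0 ≤ γ := (abs_nonneg _).trans (hs 0).2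
  have hγ2 : 0 < √(1 - γ ^ 2) := Real.sqrt_pos.2 (by nlinarith)
  have hh := hp.elementDiam_pos
  have c0 : |cross (side p 0) (twist p)| ≤ ‖side p 0‖ * ‖side p 2‖ * (M * elementDiam p) := by
    have := hp.abs_cross_opposite_le 0
    refine le_trans (le_of_eq ?_) (this.trans (mul_le_mul_of_nonneg_left
      ((le_max_left _ _).trans hM) (by positivity)))
    rw [← abs_neg]
    congr 1
    simp [cross, twist]
    ring
  have c1 : |cross (side p 1) (twist p)| ≤ ‖side p 1‖ * ‖side p 3‖ * (M * elementDiam p) := by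
    have := hp.abs_cross_opposite_le 1
    refine le_trans (le_of_eq ?_) (this.trans (mul_le_mul_of_nonneg_left
      ((le_max_right _ _).trans hM) (by positivity)))
    congr 1
    simp [cross, twist, side_zero, side_one, side_two, show (1 : Fin 4) + 2 = 3 from rfl,
      side_three]
    ring
  have hM0 : 0 ≤ M * elementDiam p := (abs_nonneg _).trans ((le_max_left _ _).trans hM)
  have cr := hs.le_abs_cross_side 0
  rw [zero_add] at cr
  have expand : cross (side p 0) (side p 1) • twist p
      = cross (side p 0) (twist p) • side p 1 - cross (side p 1) (twist p) • side p 0 := by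
    ext i
    fin_cases i <;> simp [cross] <;> ring
  have e := congrArg norm expand
  rw [norm_smul, Real.norm_eq_abs] at e
  have e2 : |cross (side p 0) (side p 1)| * ‖twist p‖
      ≤ (‖side p 0‖ * ‖side p 1‖) * (2 * (M * elementDiam p) * elementDiam p) := by
    rw [e]
    refine (norm_sub_le _ _).trans ?_
    rw [norm_smul, norm_smul, Real.norm_eq_abs, Real.norm_eq_abs]
    have b0 : |cross (side p 0) (twist p)| ≤ ‖side p 0‖ * elementDiam p * (M * elementDiam p) :=
      c0.trans (by gcongr; exact norm_side_le p 2)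
    have b1 : |cross (side p 1) (twist p)| ≤ ‖side p 1‖ * elementDiam p * (M * elementDiam p) :=
      c1.trans (by gcongr; exact norm_side_le p 3)
    calc _ ≤ ‖side p 0‖ * elementDiam p * (M * elementDiam p) * ‖side p 1‖
        + ‖side p 1‖ * elementDiam p * (M * elementDiam p) * ‖side p 0‖ := by gcongr
      _ = _ := by ring
  have hpos : 0 < ‖side p 0‖ * ‖side p 1‖ :=
    mul_pos (norm_pos_iff.2 (hp.side_ne_zero 0)) (norm_pos_iff.2 (hp.side_ne_zero 1))
  have e3 : (‖side p 0‖ * ‖side p 1‖) * (√(1 - γ ^ 2) * ‖twist p‖)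
      ≤ (‖side p 0‖ * ‖side p 1‖) * (2 * (M * elementDiam p) * elementDiam p) := by
    refine le_trans ?_ e2
    calc _ = √(1 - γ ^ 2) * (‖side p 0‖ * ‖side p 1‖) * ‖twist p‖ := by ring
      _ ≤ _ := by gcongr
  have e4 := le_of_mul_le_mul_left e3 hpos
  rw [div_mul_eq_mul_div, le_div_iff₀ hγ2]
  linarith

theorem norm_tangent_le (p : Fin 4 → Plane) (j : Fin 2) {x : Plane} (hx : x ∈ unitSquare) :
    ‖tangent p j x‖ ≤ elementDiam p := by
  have key : ∀ t ∈ Set.Icc (0 : ℝ) 1, ∀ a b : Plane, ‖a‖ ≤ elementDiam p → ‖b‖ ≤ elementDiam p →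
      ‖(1 - t) • a - t • b‖ ≤ elementDiam p := by
    intro t ht a b ha hb
    refine (norm_sub_le _ _).trans ?_
    rw [norm_smul, norm_smul, Real.norm_of_nonneg ht.1, Real.norm_of_nonneg (sub_nonneg.2 ht.2)]
    nlinarith [ht.1, ht.2]
  unfold tangent
  split_ifs
  · exact key _ (hx 1) _ _ (norm_side_le p 0) (norm_side_le p 2)
  · rw [norm_sub_rev]
    exact key _ (hx 0) _ _ (norm_side_le p 3) (norm_side_le p 1)

theorem abs_jac_le (p : Fin 4 → Plane) {x : Plane} (hx : x ∈ unitSquare) :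
    |jac p x| ≤ elementDiam p ^ 2 := by
  refine (abs_cross_le _ _).trans ?_
  rw [sq]
  exact mul_le_mul (norm_tangent_le p 0 hx) (norm_tangent_le p 1 hx) (norm_nonneg _)
    (elementDiam_nonneg p)

/-- The Jacobian determinant stays above its smallest corner value. -/
theorem IsConvexQuad.le_abs_jac {p : Fin 4 → Plane} (hp : IsConvexQuad p) {δ : ℝ}
    (h : ∀ i, δ ≤ |cross (side p i) (side p (i + 1))|) {x : Plane} (hx : x ∈ unitSquare) :
    δ ≤ |jac p x| := by
  have key : ∀ c : Fin 4 → ℝ, (∀ i, δ ≤ c i) →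
      δ ≤ (1 - x 0) * (1 - x 1) * c 3 + x 0 * (1 - x 1) * c 0 + x 0 * x 1 * c 1
        + (1 - x 0) * x 1 * c 2 := by
    intro c hc
    have s0 := (hx 0).1
    have s1 := sub_nonneg.2 (hx 0).2
    have t0 := (hx 1).1
    have t1 := sub_nonneg.2 (hx 1).2
    have a1 := mul_le_mul_of_nonneg_left (hc 3) (mul_nonneg s1 t1)
    have a2 := mul_le_mul_of_nonneg_left (hc 0) (mul_nonneg s0 t1)
    have a3 := mul_le_mul_of_nonneg_left (hc 1) (mul_nonneg s0 t0)
    have a4 := mul_le_mul_of_nonneg_left (hc 2) (mul_nonneg s1 t0)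
    linarith
  rcases hp with hp | hp
  · refine (key (fun i => cross (side p i) (side p (i + 1))) fun i => ?_).trans
      ((le_abs_self _).trans_eq' ?_)
    · exact (h i).trans_eq (abs_of_pos (hp i))
    · rw [jac_eq]; rfl
  · refine (key (fun i => -cross (side p i) (side p (i + 1))) fun i => ?_).trans
      ((neg_le_abs _).trans_eq' ?_)
    · exact (h i).trans_eq (abs_of_neg (hp i))
    · rw [jac_eq]
      simp only [show (3 : Fin 4) + 1 = 0 from rfl, show (0 : Fin 4) + 1 = 1 from rfl,
        show (1 : Fin 4) + 1 = 2 from rfl, show (2 : Fin 4) + 1 = 3 from rfl]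
      ring

theorem IsConvexQuad.jac_ne_zero {p : Fin 4 → Plane} (hp : IsConvexQuad p) {x : Plane}
    (hx : x ∈ unitSquare) : jac p x ≠ 0 := by
  have hc : ∀ i, 0 < |cross (side p i) (side p (i + 1))| := by
    intro i
    rcases hp with hp | hp
    · exact abs_pos.2 (hp i).ne'
    · exact abs_pos.2 (hp i).ne
  obtain ⟨i, hi⟩ := Finite.exists_min fun i => |cross (side p i) (side p (i + 1))|
  exact abs_pos.1 ((hc i).trans_le (hp.le_abs_jac hi hx))

/-- On shape-regular elements the Jacobian determinant is bounded below by the square of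
the diameter. -/
theorem ShapeRegular.le_abs_jac {κ γ : ℝ} {p : Fin 4 → Plane} (hs : ShapeRegular κ γ p)
    (hp : IsConvexQuad p) {x : Plane} (hx : x ∈ unitSquare) :
    √(1 - γ ^ 2) / κ ^ 2 * elementDiam p ^ 2 ≤ |jac p x| := by
  refine hp.le_abs_jac (fun i => le_trans ?_ (hs.le_abs_cross_side i)) hx
  have hh := hp.elementDiam_pos
  have hκ : 0 < κ := by
    by_contra hκ
    nlinarith [(hs 0).1, norm_nonneg (side p 0)]
  have b0 : elementDiam p / κ ≤ ‖side p i‖ := (div_le_iff₀' hκ).2 (hs i).1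
  have b1 : elementDiam p / κ ≤ ‖side p (i + 1)‖ := (div_le_iff₀' hκ).2 (hs (i + 1)).1
  calc _ = √(1 - γ ^ 2) * (elementDiam p / κ * (elementDiam p / κ)) := by field_simp
    _ ≤ _ := by gcongr

/-- The twist is the only second derivative of the bilinear map that need not vanish. -/
theorem w2infSeminorm_bilinearMap_le (p : Fin 4 → Plane) :
    w2infSeminorm (bilinearMap p) ≤ ‖twist p‖ₑ := by
  refine iSup₂_le fun x _ => iSup₂_le fun i j => ?_
  rw [partialDeriv_bilinearMap, partialDeriv_tangent]
  split_ifs <;> simp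

end QuadFE

/-! ### Test functions and weak derivatives -/

namespace QuadFE

/-- `φ` is a test function on `U`: smooth, with compact support contained in `U`. -/
structure IsTest (U : Set Plane) (φ : Plane → ℝ) : Prop where
  contDiff : ContDiff ℝ ∞ φ
  hasCompactSupport : HasCompactSupport φ
  tsupport_subset : tsupport φ ⊆ U

theorem contDiff_partialDeriv {φ : Plane → ℝ} (h : ContDiff ℝ ∞ φ) (i : Fin 2) :
    ContDiff ℝ ∞ (partialDeriv i φ) :=
  (h.fderiv_right (m := ∞) (by simp)).clm_apply contDiff_const

theorem differentiable_of_contDiff {φ : Plane → ℝ} (h : ContDiff ℝ ∞ φ) : Differentiable ℝ φ :=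
  h.differentiable (by simp)

theorem partialDeriv_add {f g : Plane → ℝ} (hf : ContDiff ℝ ∞ f) (hg : ContDiff ℝ ∞ g)
    (i : Fin 2) : partialDeriv i (f + g) = partialDeriv i f + partialDeriv i g := by
  ext x
  simp [partialDeriv, fderiv_add (differentiable_of_contDiff hf x)
    (differentiable_of_contDiff hg x)]

theorem partialDeriv_mul {f g : Plane → ℝ} (hf : ContDiff ℝ ∞ f) (hg : ContDiff ℝ ∞ g)
    (i : Fin 2) : partialDeriv i (f * g) = f * partialDeriv i g + partialDeriv i f * g := by
  ext x
  simp [partialDeriv, fderiv_mul (differentiable_of_contDiff hf x)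
    (differentiable_of_contDiff hg x), mul_comm]

theorem partialDeriv_comm {f : Plane → ℝ} (hf : ContDiff ℝ ∞ f) (i j : Fin 2) :
    partialDeriv i (partialDeriv j f) = partialDeriv j (partialDeriv i f) := by
  have hd : Differentiable ℝ (fderiv ℝ f) :=
    (hf.fderiv_right (m := ∞) (by simp)).differentiable (by simp)
  ext x
  have key : ∀ a b : Plane,
      fderiv ℝ (fun y => fderiv ℝ f y a) x b = fderiv ℝ (fderiv ℝ f) x b a := by
    intro a b
    rw [fderiv_clm_apply (hd x) (differentiableAt_const a)]
    simp
  have hs := (hf.contDiffAt (x := x)).isSymmSndFDerivAt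
    (by simpa using WithTop.coe_le_coe.2 (le_top (a := (2 : ℕ∞))))
  simp only [partialDeriv]
  rw [show partialDeriv j f = fun y => fderiv ℝ f y (EuclideanSpace.single j (1 : ℝ)) from rfl,
    show partialDeriv i f = fun y => fderiv ℝ f y (EuclideanSpace.single i (1 : ℝ)) from rfl,
    key, key, hs.eq]

theorem contDiff_iterate_partialDeriv {φ : Plane → ℝ} (h : ContDiff ℝ ∞ φ) (i : Fin 2) (n : ℕ) :
    ContDiff ℝ ∞ ((partialDeriv i)^[n] φ) := by
  induction n with
  | zero => exact h
  | succ n ih => rw [Function.iterate_succ_apply']; exact contDiff_partialDeriv ih i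

theorem iterate_partialDeriv_comm {f : Plane → ℝ} (hf : ContDiff ℝ ∞ f) (i j : Fin 2) (n : ℕ) :
    (partialDeriv i)^[n] (partialDeriv j f) = partialDeriv j ((partialDeriv i)^[n] f) := by
  induction n with
  | zero => rfl
  | succ n ih =>
    rw [Function.iterate_succ_apply', ih, Function.iterate_succ_apply',
      partialDeriv_comm (contDiff_iterate_partialDeriv hf i n)]

namespace IsTest

variable {U : Set Plane} {φ ψ : Plane → ℝ}

theorem mono {W : Set Plane} (h : IsTest U φ) (hUW : U ⊆ W) : IsTest W φ :=
  ⟨h.1, h.2, h.3.trans hUW⟩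

theorem partialDeriv (h : IsTest U φ) (i : Fin 2) : IsTest U (partialDeriv i φ) :=
  ⟨contDiff_partialDeriv h.1 i, h.2.fderiv_apply ℝ _, (tsupport_fderiv_apply_subset ℝ _).trans h.3⟩

theorem iterate_partialDeriv (h : IsTest U φ) (i : Fin 2) (n : ℕ) :
    IsTest U ((QuadFE.partialDeriv i)^[n] φ) := by
  induction n with
  | zero => exact h
  | succ n ih => rw [Function.iterate_succ_apply']; exact ih.partialDeriv i

theorem multiDeriv (h : IsTest U φ) (α : ℕ × ℕ) : IsTest U (multiDeriv α φ) :=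
  (h.iterate_partialDeriv 1 α.2).iterate_partialDeriv 0 α.1

theorem mul_left (h : IsTest U φ) {f : Plane → ℝ} (hf : ContDiff ℝ ∞ f) : IsTest U (f * φ) :=
  ⟨hf.mul h.1, h.2.mul_left, (tsupport_mul_subset_right).trans h.3⟩

theorem add (h : IsTest U φ) (h' : IsTest U ψ) : IsTest U (φ + ψ) :=
  ⟨h.1.add h'.1, h.2.add h'.2, (tsupport_add φ ψ).trans (Set.union_subset h.3 h'.3)⟩

theorem const_mul (h : IsTest U φ) (c : ℝ) : IsTest U (fun x => c * φ x) :=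
  h.mul_left (contDiff_const (c := c))

theorem memLp (h : IsTest U φ) (μ : Measure Plane) [IsFiniteMeasureOnCompacts μ] : MemLp φ 2 μ :=
  h.1.continuous.memLp_of_hasCompactSupport h.2

theorem integrable_mul (h : IsTest U φ) {v : Plane → ℝ} {W : Set Plane}
    (hv : MemLp v 2 (volume.restrict W)) :
    Integrable (fun x => v x * φ x) (volume.restrict W) :=
  hv.integrable_mul (h.memLp _)

theorem eq_zero (h : IsTest U φ) {x : Plane} (hx : x ∉ U) : φ x = 0 :=
  image_eq_zero_of_notMem_tsupport fun hx' => hx (h.3 hx')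

theorem setIntegral_mul (h : IsTest U φ) (v : Plane → ℝ) :
    ∫ x in U, v x * φ x = ∫ x, v x * φ x :=
  setIntegral_eq_integral_of_forall_compl_eq_zero fun x hx => by rw [h.eq_zero hx, mul_zero]

end IsTest

/-- `g` is the first order weak derivative of `v` on `U` in the `i`-th coordinate. -/
def WeakPartial (U : Set Plane) (i : Fin 2) (v g : Plane → ℝ) : Prop :=
  ∀ φ : Plane → ℝ, IsTest U φ → ∫ x in U, v x * partialDeriv i φ x = -∫ x in U, g x * φ x

/-- `v` is square integrable on `U` together with its iterated weak derivatives up to order `k`,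
and the derivatives of order `n` have `L²` norms at most `A n`. -/
def WeakBound : ℕ → Set Plane → (Plane → ℝ) → (ℕ → ℝ≥0∞) → Prop
  | 0, U, v, A => MemLp v 2 (volume.restrict U) ∧ eLpNorm v 2 (volume.restrict U) ≤ A 0
  | k + 1, U, v, A => (MemLp v 2 (volume.restrict U) ∧ eLpNorm v 2 (volume.restrict U) ≤ A 0) ∧
      ∀ i, ∃ g, WeakPartial U i v g ∧ WeakBound k U g (fun n => A (n + 1))

theorem WeakPartial.mono {U W : Set Plane} {i : Fin 2} {v g : Plane → ℝ}
    (h : WeakPartial W i v g) (hUW : U ⊆ W) : WeakPartial U i v g := by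
  intro φ hφ
  have := h φ (hφ.mono hUW)
  rwa [(hφ.mono hUW).setIntegral_mul, ((hφ.mono hUW).partialDeriv i).setIntegral_mul,
    ← hφ.setIntegral_mul, ← (hφ.partialDeriv i).setIntegral_mul] at this

theorem WeakPartial.add {U : Set Plane} {i : Fin 2} {v g w k : Plane → ℝ}
    (h : WeakPartial U i v g) (h' : WeakPartial U i w k) (hv : MemLp v 2 (volume.restrict U))
    (hw : MemLp w 2 (volume.restrict U)) (hg : MemLp g 2 (volume.restrict U))
    (hk : MemLp k 2 (volume.restrict U)) : WeakPartial U i (v + w) (g + k) := by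
  intro φ hφ
  simp only [Pi.add_apply, add_mul]
  rw [integral_add ((hφ.partialDeriv i).integrable_mul hv) ((hφ.partialDeriv i).integrable_mul hw),
    integral_add (hφ.integrable_mul hg) (hφ.integrable_mul hk), h φ hφ, h' φ hφ]
  ring

/-- A smooth function has its classical partial derivatives as weak ones. -/
theorem weakPartial_of_contDiff (U : Set Plane) (i : Fin 2) {f : Plane → ℝ}
    (hf : ContDiff ℝ ∞ f) : WeakPartial U i f (partialDeriv i f) := by
  intro φ hφ
  rw [hφ.setIntegral_mul, (hφ.partialDeriv i).setIntegral_mul]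
  have key : ∀ g k : Plane → ℝ, ContDiff ℝ ∞ g → IsTest U k → Integrable fun x => g x * k x :=
    fun g k hg hk => (hg.continuous.mul hk.1.continuous).integrable_of_hasCompactSupport
      hk.2.mul_left
  exact integral_mul_fderiv_eq_neg_fderiv_mul_of_integrable
    (key _ _ (contDiff_partialDeriv hf i) hφ) (key _ _ hf (hφ.partialDeriv i)) (key _ _ hf hφ)
    (fun x _ => differentiable_of_contDiff hf x) (fun x _ => differentiable_of_contDiff hφ.1 x)

theorem WeakBound.memLp {k : ℕ} {U : Set Plane} {v : Plane → ℝ} {A : ℕ → ℝ≥0∞}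
    (h : WeakBound k U v A) : MemLp v 2 (volume.restrict U) := by
  cases k
  exacts [h.1, h.1.1]

theorem WeakBound.eLpNorm_le {k : ℕ} {U : Set Plane} {v : Plane → ℝ} {A : ℕ → ℝ≥0∞}
    (h : WeakBound k U v A) : eLpNorm v 2 (volume.restrict U) ≤ A 0 := by
  cases k
  exacts [h.2, h.1.2]

theorem WeakBound.mono_bound {k : ℕ} {U : Set Plane} {v : Plane → ℝ} {A B : ℕ → ℝ≥0∞}
    (h : WeakBound k U v A) (hAB : ∀ n ≤ k, A n ≤ B n) : WeakBound k U v B := by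
  induction k generalizing v A B with
  | zero => exact ⟨h.1, h.2.trans (hAB 0 le_rfl)⟩
  | succ k ih =>
    refine ⟨⟨h.1.1, h.1.2.trans (hAB 0 (Nat.zero_le _))⟩, fun i => ?_⟩
    obtain ⟨g, hg, hg'⟩ := h.2 i
    exact ⟨g, hg, ih hg' fun n hn => hAB _ (by omega)⟩

theorem WeakBound.of_succ {k : ℕ} {U : Set Plane} {v : Plane → ℝ} {A : ℕ → ℝ≥0∞}
    (h : WeakBound (k + 1) U v A) : WeakBound k U v A := by
  induction k generalizing v A with
  | zero => exact h.1
  | succ k ih =>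
    refine ⟨h.1, fun i => ?_⟩
    obtain ⟨g, hg, hg'⟩ := h.2 i
    exact ⟨g, hg, ih hg'⟩

theorem WeakBound.mono_set {k : ℕ} {U W : Set Plane} {v : Plane → ℝ} {A : ℕ → ℝ≥0∞}
    (h : WeakBound k W v A) (hUW : U ⊆ W) : WeakBound k U v A := by
  have hr := Measure.restrict_mono_set volume hUW
  induction k generalizing v A with
  | zero => exact ⟨h.1.mono_measure hr, (eLpNorm_mono_measure _ hr).trans h.2⟩
  | succ k ih =>
    refine ⟨⟨h.1.1.mono_measure hr, (eLpNorm_mono_measure _ hr).trans h.1.2⟩, fun i => ?_⟩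
    obtain ⟨g, hg, hg'⟩ := h.2 i
    exact ⟨g, hg.mono hUW, ih hg'⟩

theorem WeakBound.add {k : ℕ} {U : Set Plane} {v w : Plane → ℝ} {A B : ℕ → ℝ≥0∞}
    (h : WeakBound k U v A) (h' : WeakBound k U w B) : WeakBound k U (v + w) (A + B) := by
  have h0 : eLpNorm (v + w) 2 (volume.restrict U) ≤ (A + B) 0 :=
    (eLpNorm_add_le h.memLp.1 h'.memLp.1 (by norm_num)).trans
      (add_le_add h.eLpNorm_le h'.eLpNorm_le)
  induction k generalizing v w A B with
  | zero => exact ⟨h.1.add h'.1, h0⟩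
  | succ k ih =>
    refine ⟨⟨h.memLp.add h'.memLp, h0⟩, fun i => ?_⟩
    obtain ⟨g, hg, hg'⟩ := h.2 i
    obtain ⟨l, hl, hl'⟩ := h'.2 i
    refine ⟨g + l, hg.add hl h.memLp h'.memLp hg'.memLp hl'.memLp, ih hg' hl' ?_⟩
    exact (eLpNorm_add_le hg'.memLp.1 hl'.memLp.1 (by norm_num)).trans
      (add_le_add hg'.eLpNorm_le hl'.eLpNorm_le)

theorem hasWeakDeriv_iff {U : Set Plane} {α : ℕ × ℕ} {v g : Plane → ℝ} :
    HasWeakDeriv U α v g ↔ ∀ φ, IsTest U φ →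
      ∫ x in U, v x * multiDeriv α φ x = (-1) ^ (α.1 + α.2) * ∫ x in U, g x * φ x :=
  ⟨fun h φ hφ => h φ hφ.1 hφ.2 hφ.3, fun h φ h1 h2 h3 => h φ ⟨h1, h2, h3⟩⟩

/-- The multi-index of a single derivative in the `i`-th coordinate. -/
def unitIndex (i : Fin 2) : ℕ × ℕ := if i = 0 then (1, 0) else (0, 1)

theorem unitIndex_sum (i : Fin 2) : (unitIndex i).1 + (unitIndex i).2 = 1 := by
  fin_cases i <;> simp [unitIndex]

theorem unitIndex_add_sum (α : ℕ × ℕ) (i : Fin 2) :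
    (α + unitIndex i).1 + (α + unitIndex i).2 = α.1 + α.2 + 1 := by
  have := unitIndex_sum i
  simp only [Prod.fst_add, Prod.snd_add]
  omega

theorem multiDeriv_partialDeriv {φ : Plane → ℝ} (hφ : ContDiff ℝ ∞ φ) (α : ℕ × ℕ) (i : Fin 2) :
    multiDeriv α (partialDeriv i φ) = multiDeriv (α + unitIndex i) φ := by
  fin_cases i
  · simp only [multiDeriv, unitIndex, Fin.zero_eta, if_true, Prod.fst_add, Prod.snd_add, add_zero,
      Function.iterate_succ_apply]
    rw [iterate_partialDeriv_comm hφ]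
  · simp [multiDeriv, unitIndex, Function.iterate_succ_apply]

/-- Weak derivatives of one function whose multi-indices differ by one derivative are linked by a
weak partial derivative. -/
theorem HasWeakDeriv.weakPartial {U : Set Plane} {α : ℕ × ℕ} {v g k : Plane → ℝ} {i : Fin 2}
    (h : HasWeakDeriv U α v g) (h' : HasWeakDeriv U (α + unitIndex i) v k) :
    WeakPartial U i g k := by
  rw [hasWeakDeriv_iff] at h h'
  intro φ hφ
  have h1 := h _ (hφ.partialDeriv i)
  have h2 := h' φ hφ
  rw [multiDeriv_partialDeriv hφ.1, h2, unitIndex_add_sum, pow_succ, mul_assoc] at h1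
  have := mul_left_cancel₀ (pow_ne_zero _ (by norm_num)) h1
  rw [← this]
  ring

theorem hasWeakDeriv_zero (U : Set Plane) (v : Plane → ℝ) : HasWeakDeriv U (0, 0) v v := by
  intro φ _ _ _
  simp [multiDeriv]

/-- A tree of iterated weak derivatives contains all weak derivatives of multi-index type. -/
theorem WeakBound.exists_hasWeakDeriv {k : ℕ} {U : Set Plane} {v : Plane → ℝ} {A : ℕ → ℝ≥0∞}
    (h : WeakBound k U v A) (a b : ℕ) (hab : a + b ≤ k) :
    ∃ g, HasWeakDeriv U (a, b) v g ∧ MemLp g 2 (volume.restrict U) ∧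
      eLpNorm g 2 (volume.restrict U) ≤ A (a + b) := by
  induction k generalizing v A a b with
  | zero =>
    obtain ⟨rfl, rfl⟩ : a = 0 ∧ b = 0 := by omega
    exact ⟨v, hasWeakDeriv_zero U v, h⟩
  | succ k ih =>
    rcases a with _ | a
    · rcases b with _ | b
      · exact ⟨v, hasWeakDeriv_zero U v, h.1⟩
      · obtain ⟨g, hg, hg'⟩ := h.2 1
        obtain ⟨l, hl, hl'⟩ := ih hg' 0 b (by omega)
        refine ⟨l, ?_, by rwa [show 0 + (b + 1) = 0 + b + 1 from rfl]⟩
        rw [hasWeakDeriv_iff] at hl ⊢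
        intro φ hφ
        have := hg _ (hφ.multiDeriv (0, b))
        rw [hl φ hφ] at this
        simp only [multiDeriv, Function.iterate_zero, id, Function.iterate_succ_apply'] at this ⊢
        rw [this]
        ring
    · obtain ⟨g, hg, hg'⟩ := h.2 0
      obtain ⟨l, hl, hl'⟩ := ih hg' a b (by omega)
      refine ⟨l, ?_, by convert hl' using 2; rw [Nat.add_right_comm]⟩
      rw [hasWeakDeriv_iff] at hl ⊢
      intro φ hφ
      have := hg _ (hφ.multiDeriv (a, b))
      rw [hl φ hφ] at this
      simp only [multiDeriv, Function.iterate_succ_apply'] at this ⊢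
      rw [this]
      ring

/-- A square integrable function orthogonal to all test functions vanishes. -/
theorem ae_eq_zero_of_test {U : Set Plane} (hU : IsOpen U) {f : Plane → ℝ}
    (hf : MemLp f 2 (volume.restrict U)) (h : ∀ φ, IsTest U φ → ∫ x in U, f x * φ x = 0) :
    f =ᵐ[volume.restrict U] 0 := by
  have hl : LocallyIntegrableOn f U volume :=
    locallyIntegrableOn_of_locallyIntegrable_restrict (hf.locallyIntegrable (by norm_num))
  have := hU.ae_eq_zero_of_integral_contDiff_smul_eq_zero hl fun φ h1 h2 h3 => by
    have hφ : IsTest U φ := ⟨h1, h2, h3⟩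
    rw [← h φ hφ, hφ.setIntegral_mul]
    simp [mul_comm]
  exact (ae_restrict_iff' hU.measurableSet).2 this

/-- Square integrable weak derivatives are unique almost everywhere. -/
theorem HasWeakDeriv.ae_eq {U : Set Plane} (hU : IsOpen U) {α : ℕ × ℕ} {v g k : Plane → ℝ}
    (h : HasWeakDeriv U α v g) (h' : HasWeakDeriv U α v k) (hg : MemLp g 2 (volume.restrict U))
    (hk : MemLp k 2 (volume.restrict U)) : g =ᵐ[volume.restrict U] k := by
  rw [hasWeakDeriv_iff] at h h'
  have := ae_eq_zero_of_test hU (hg.sub hk) fun φ hφ => by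
    simp only [Pi.sub_apply, sub_mul]
    rw [integral_sub (hφ.integrable_mul hg) (hφ.integrable_mul hk), sub_eq_zero]
    exact mul_left_cancel₀ (pow_ne_zero _ (by norm_num)) ((h φ hφ).symm.trans (h' φ hφ))
  filter_upwards [this] with x hx
  exact sub_eq_zero.1 hx

theorem weakDeriv_spec {U : Set Plane} {α : ℕ × ℕ} {v g : Plane → ℝ}
    (h : HasWeakDeriv U α v g) (hg : MemLp g 2 (volume.restrict U)) :
    MemLp (weakDeriv U α v) 2 (volume.restrict U) ∧ HasWeakDeriv U α v (weakDeriv U α v) := by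
  have : ∃ g, MemLp g 2 (volume.restrict U) ∧ HasWeakDeriv U α v g := ⟨g, hg, h⟩
  rw [weakDeriv, dif_pos this]
  exact this.choose_spec

theorem HasWeakDeriv.eLpNorm_weakDeriv {U : Set Plane} (hU : IsOpen U) {α : ℕ × ℕ}
    {v g : Plane → ℝ} (h : HasWeakDeriv U α v g) (hg : MemLp g 2 (volume.restrict U)) :
    eLpNorm (weakDeriv U α v) 2 (volume.restrict U) = eLpNorm g 2 (volume.restrict U) := by
  obtain ⟨h1, h2⟩ := weakDeriv_spec h hg
  exact eLpNorm_congr_ae (h2.ae_eq hU h h1 hg)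

theorem MemSobolev.weakDeriv_spec {m : ℕ} {U : Set Plane} {v : Plane → ℝ} (h : MemSobolev m U v)
    {α : ℕ × ℕ} (hα : α.1 + α.2 ≤ m) :
    MemLp (weakDeriv U α v) 2 (volume.restrict U) ∧ HasWeakDeriv U α v (weakDeriv U α v) := by
  obtain ⟨g, hg, hg'⟩ := h.2 α hα
  exact QuadFE.weakDeriv_spec hg' hg

theorem eLpNorm_weakDeriv_le_sobolevNorm {m : ℕ} (U : Set Plane) (v : Plane → ℝ)
    {α : ℕ × ℕ} (hα : α.1 + α.2 ≤ m) :
    eLpNorm (weakDeriv U α v) 2 (volume.restrict U) ≤ sobolevNorm m U v := by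
  have h1 : eLpNorm (weakDeriv U α v) 2 (volume.restrict U) ^ 2 ≤
      ∑ k ∈ Finset.range (m + 1), ∑ α ∈ Finset.HasAntidiagonal.antidiagonal k,
        eLpNorm (weakDeriv U α v) 2 (volume.restrict U) ^ 2 := by
    refine le_trans ?_ (Finset.single_le_sum (fun _ _ => zero_le)
      (Finset.mem_range.2 (Nat.lt_succ_of_le hα)))
    exact Finset.single_le_sum
      (f := fun α => eLpNorm (weakDeriv U α v) 2 (volume.restrict U) ^ 2) (fun _ _ => zero_le)
      (Finset.HasAntidiagonal.mem_antidiagonal.2 rfl)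
  have h2 := ENNReal.rpow_le_rpow h1 (show (0 : ℝ) ≤ 1 / 2 by norm_num)
  rwa [← ENNReal.rpow_natCast, ← ENNReal.rpow_mul, Nat.cast_ofNat,
    show (2 : ℝ) * (1 / 2) = 1 by norm_num, ENNReal.rpow_one] at h2

theorem sobolevNorm_le {m : ℕ} {U : Set Plane} {v : Plane → ℝ} {A : ℝ≥0∞}
    (h : ∀ α : ℕ × ℕ, α.1 + α.2 ≤ m → eLpNorm (weakDeriv U α v) 2 (volume.restrict U) ≤ A) :
    sobolevNorm m U v ≤ ((m + 1) ^ 2 : ℕ) * A := by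
  have h1 : (∑ k ∈ Finset.range (m + 1), ∑ α ∈ Finset.HasAntidiagonal.antidiagonal k,
      eLpNorm (weakDeriv U α v) 2 (volume.restrict U) ^ 2) ≤ (((m + 1) ^ 2 : ℕ) * A) ^ 2 := by
    have e : ∀ k ∈ Finset.range (m + 1), (∑ α ∈ Finset.HasAntidiagonal.antidiagonal k,
        eLpNorm (weakDeriv U α v) 2 (volume.restrict U) ^ 2) ≤ ((m + 1 : ℕ) : ℝ≥0∞) * A ^ 2 := by
      intro k hk
      have hk' := Finset.mem_range.1 hk
      refine (Finset.sum_le_card_nsmul _ _ (A ^ 2) fun α hα => ?_).trans ?_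
      · have := Finset.HasAntidiagonal.mem_antidiagonal.1 hα
        gcongr
        exact h α (by omega)
      · rw [Finset.Nat.card_antidiagonal, nsmul_eq_mul]
        gcongr
        omega
    refine (Finset.sum_le_card_nsmul _ _ _ e).trans ?_
    rw [Finset.card_range, nsmul_eq_mul, ← mul_assoc, mul_pow]
    gcongr
    norm_cast
    rw [← sq]
    exact Nat.le_self_pow (by norm_num) _
  have h2 := ENNReal.rpow_le_rpow h1 (show (0 : ℝ) ≤ 1 / 2 by norm_num)
  rwa [← ENNReal.rpow_natCast, ← ENNReal.rpow_mul, Nat.cast_ofNat,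
    show (2 : ℝ) * (1 / 2) = 1 by norm_num, ENNReal.rpow_one] at h2

theorem MemSobolev.eLpNorm_le {m : ℕ} {U : Set Plane} (hU : IsOpen U) {v : Plane → ℝ}
    (h : MemSobolev m U v) : eLpNorm v 2 (volume.restrict U) ≤ sobolevNorm m U v := by
  rw [← (hasWeakDeriv_zero U v).eLpNorm_weakDeriv hU h.1]
  exact eLpNorm_weakDeriv_le_sobolevNorm U v (by simp)

theorem WeakBound.memSobolev {k : ℕ} {U : Set Plane} {v : Plane → ℝ} {A : ℕ → ℝ≥0∞}
    (h : WeakBound k U v A) : MemSobolev k U v := by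
  refine ⟨h.memLp, fun α hα => ?_⟩
  obtain ⟨g, hg, hg', -⟩ := h.exists_hasWeakDeriv α.1 α.2 hα
  exact ⟨g, hg', hg⟩

theorem MemSobolev.weakBound {m : ℕ} {U : Set Plane} (hU : IsOpen U) {v : Plane → ℝ}
    (h : MemSobolev m U v) : WeakBound m U v fun _ => sobolevNorm m U v := by
  have key : ∀ k : ℕ, ∀ α : ℕ × ℕ, α.1 + α.2 + k ≤ m → ∀ g, MemLp g 2 (volume.restrict U) →
      HasWeakDeriv U α v g → WeakBound k U g fun _ => sobolevNorm m U v := by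
    intro k
    induction k with
    | zero =>
      intro α hα g hg hg'
      exact ⟨hg, (hg'.eLpNorm_weakDeriv hU hg).symm.trans_le
        (eLpNorm_weakDeriv_le_sobolevNorm U v (by omega))⟩
    | succ k ih =>
      intro α hα g hg hg'
      refine ⟨⟨hg, (hg'.eLpNorm_weakDeriv hU hg).symm.trans_le
        (eLpNorm_weakDeriv_le_sobolevNorm U v (by omega))⟩, fun i => ?_⟩
      have e := unitIndex_sum i
      have hle : (α + unitIndex i).1 + (α + unitIndex i).2 + k ≤ m := by
        simp only [Prod.fst_add, Prod.snd_add]; omega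
      obtain ⟨l, hl, hl'⟩ := h.2 (α + unitIndex i) (by omega)
      exact ⟨l, hg'.weakPartial hl', ih _ hle l hl hl'⟩
  exact key m (0, 0) (by simp) v h.1 (hasWeakDeriv_zero U v)

theorem inner_toLp {μ : Measure Plane} {f g : Plane → ℝ} (hf : MemLp f 2 μ) (hg : MemLp g 2 μ) :
    inner ℝ (hf.toLp f) (hg.toLp g) = ∫ x, f x * g x ∂μ := by
  rw [L2.inner_def]
  refine integral_congr_ae ?_
  filter_upwards [hf.coeFn_toLp, hg.coeFn_toLp] with x h1 h2
  rw [h1, h2]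
  simp [mul_comm]

theorem abs_integral_mul_le {μ : Measure Plane} {f g : Plane → ℝ} (hf : MemLp f 2 μ)
    (hg : MemLp g 2 μ) :
    |∫ x, f x * g x ∂μ| ≤ (eLpNorm f 2 μ).toReal * (eLpNorm g 2 μ).toReal := by
  rw [← inner_toLp hf hg, ← Lp.norm_toLp f hf, ← Lp.norm_toLp g hg]
  exact abs_real_inner_le_norm _ _

theorem eLpNorm_toReal_sq {μ : Measure Plane} {f : Plane → ℝ} (hf : MemLp f 2 μ) :
    (eLpNorm f 2 μ).toReal ^ 2 = ∫ x, f x ^ 2 ∂μ := by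
  rw [← Lp.norm_toLp f hf, ← real_inner_self_eq_norm_sq, inner_toLp hf hf]
  simp [sq]

/-- The `L²` norm is determined by duality with test functions, since these are dense in `L²`. -/
theorem eLpNorm_le_of_test {U : Set Plane} (hU : IsOpen U) {f : Plane → ℝ}
    (hf : MemLp f 2 (volume.restrict U)) {K : ℝ}
    (h : ∀ φ, IsTest U φ →
      |∫ x in U, f x * φ x| ≤ K * (eLpNorm φ 2 (volume.restrict U)).toReal) :
    eLpNorm f 2 (volume.restrict U) ≤ ENNReal.ofReal K := by
  let S : Submodule ℝ (Lp ℝ 2 (volume.restrict U)) :=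
    { carrier := {F | ∃ φ, ∃ hφ : IsTest U φ, F = (hφ.memLp (volume.restrict U)).toLp φ}
      add_mem' := by
        rintro _ _ ⟨φ, hφ, rfl⟩ ⟨ψ, hψ, rfl⟩
        exact ⟨φ + ψ, hφ.add hψ, (MemLp.toLp_add _ _).symm⟩
      zero_mem' := by
        refine ⟨0, ⟨contDiff_const, HasCompactSupport.zero, by simp [tsupport]⟩, ?_⟩
        rw [MemLp.toLp_zero]
      smul_mem' := by
        rintro c _ ⟨φ, hφ, rfl⟩
        exact ⟨fun x => c * φ x, hφ.const_mul c, (MemLp.toLp_const_smul c _).symm⟩ }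
  have hS : S.topologicalClosure = ⊤ := by
    rw [Submodule.topologicalClosure_eq_top_iff, Submodule.eq_bot_iff]
    intro F hF
    have hF' := Lp.memLp F
    have := ae_eq_zero_of_test hU hF' fun φ hφ => by
      rw [← inner_toLp hF' (hφ.memLp _), Lp.toLp_coeFn, real_inner_comm]
      exact Submodule.inner_right_of_mem_orthogonal
        (show (hφ.memLp (volume.restrict U)).toLp φ ∈ S from ⟨φ, hφ, rfl⟩) hF
    exact (Lp.eq_zero_iff_ae_eq_zero).2 this
  have hcl : IsClosed {F : Lp ℝ 2 (volume.restrict U) | |inner ℝ (hf.toLp f) F| ≤ K * ‖F‖} :=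
    isClosed_le (by fun_prop) (by fun_prop)
  have hsub : closure (S : Set (Lp ℝ 2 (volume.restrict U))) ⊆
      {F | |inner ℝ (hf.toLp f) F| ≤ K * ‖F‖} := by
    refine closure_minimal ?_ hcl
    rintro _ ⟨φ, hφ, rfl⟩
    rw [Set.mem_ofPred_eq, inner_toLp hf, Lp.norm_toLp]
    exact h φ hφ
  have hmem : hf.toLp f ∈ closure (S : Set (Lp ℝ 2 (volume.restrict U))) := by
    rw [← Submodule.topologicalClosure_coe, hS]
    trivial
  have := hsub hmem
  rw [Set.mem_ofPred_eq, real_inner_self_eq_norm_sq, abs_of_nonneg (by positivity), sq,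
    Lp.norm_toLp] at this
  rw [← ENNReal.ofReal_toReal hf.2.ne]
  rcases (ENNReal.toReal_nonneg (a := eLpNorm f 2 (volume.restrict U))).eq_or_lt with h0 | h0
  · rw [← h0]; simp
  · exact ENNReal.ofReal_le_ofReal (le_of_mul_le_mul_right this h0)

end QuadFE

/-! ### The Poincaré inequality on the unit square -/

namespace QuadFE

theorem partialDeriv_eq_of_hasDerivAt {f : Plane → ℝ} (hf : ContDiff ℝ ∞ f) {i : Fin 2} {x : Plane}
    {d : ℝ} (h : HasDerivAt (fun t : ℝ => f (x + t • EuclideanSpace.single i (1 : ℝ))) d 0) :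
    partialDeriv i f x = d := by
  rw [partialDeriv, ← (differentiable_of_contDiff hf x).lineDeriv_eq_fderiv]
  exact h.deriv

theorem vec2_eta (x : Plane) : !₂[x 0, x 1] = x := by
  ext i; fin_cases i <;> rfl

theorem contDiff_vec2 : ContDiff ℝ ∞ fun q : ℝ × ℝ => (!₂[q.1, q.2] : Plane) := by
  rw [contDiff_euclidean]
  intro i
  fin_cases i
  exacts [contDiff_fst, contDiff_snd]

theorem continuous_vec2 : Continuous fun q : ℝ × ℝ => (!₂[q.1, q.2] : Plane) :=
  contDiff_vec2.continuous

theorem contDiff_primitive {k : ℝ → ℝ} (hk : ContDiff ℝ ∞ k) :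
    ContDiff ℝ ∞ fun x => ∫ t in (0 : ℝ)..x, k t := by
  have hd : ∀ x, HasDerivAt (fun x => ∫ t in (0 : ℝ)..x, k t) (k x) x := fun x =>
    intervalIntegral.integral_hasDerivAt_right (hk.continuous.intervalIntegrable _ _)
      (hk.continuous.stronglyMeasurableAtFilter _ _) hk.continuous.continuousAt
  rw [contDiff_infty_iff_deriv]
  refine ⟨fun x => (hd x).differentiableAt, ?_⟩
  rwa [show deriv (fun x => ∫ t in (0 : ℝ)..x, k t) = k from funext fun x => (hd x).deriv]

/-- The primitive in the first coordinate is a convolution with the Heaviside function, hence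
smooth in both coordinates. -/
theorem contDiff_partial_primitive {φ : Plane → ℝ} (hφ : ContDiff ℝ ∞ φ)
    (h0 : ∀ x : Plane, x 0 ∉ Set.Icc (0 : ℝ) 1 → φ x = 0) :
    ContDiff ℝ ∞ fun x : Plane => ∫ t in (0 : ℝ)..x 0, φ !₂[t, x 1] := by
  have hloc : LocallyIntegrable ((Set.Ioi (0 : ℝ)).indicator fun _ => (1 : ℝ)) volume :=
    (locallyIntegrable_const (1 : ℝ)).indicator measurableSet_Ioi
  have hc := contDiffOn_convolution_right_with_param (n := ⊤) (μ := (volume : Measure ℝ))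
    (ContinuousLinearMap.mul ℝ ℝ)
    (g := fun y s : ℝ => φ !₂[s, y]) isOpen_univ (isCompact_Icc (a := (0 : ℝ)) (b := 1))
    (fun y s _ hs => h0 _ hs) hloc
    ((hφ.comp (contDiff_vec2.comp (contDiff_snd.prodMk contDiff_fst))).contDiffOn)
  rw [Set.univ_prod_univ, contDiffOn_univ] at hc
  have hc' := hc.comp (g := fun q : ℝ × ℝ => _) (f := fun x : Plane => (x 1, x 0))
    (by fun_prop)
  have e : (fun x : Plane => ∫ t in (0 : ℝ)..x 0, φ !₂[t, x 1]) = (fun q : ℝ × ℝ =>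
      (convolution ((Set.Ioi (0 : ℝ)).indicator fun _ => (1 : ℝ)) (fun s => φ !₂[s, q.1])
        (ContinuousLinearMap.mul ℝ ℝ) volume) q.2) ∘ fun x : Plane => (x 1, x 0) := ?_
  · rw [e]; exact hc'
  ext x
  have hcont : Continuous fun s : ℝ => φ !₂[s, x 1] :=
    hφ.continuous.comp (continuous_vec2.comp (continuous_id.prodMk continuous_const))
  have hint : Integrable fun s : ℝ => φ !₂[s, x 1] :=
    hcont.integrable_of_hasCompactSupport
      (HasCompactSupport.intro isCompact_Icc fun s hs => h0 _ hs)
  have e0 : ∫ s in Set.Iic (0 : ℝ), φ !₂[s, x 1] = 0 := by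
    rw [integral_Iic_eq_integral_Iio]
    refine setIntegral_eq_zero_of_forall_eq_zero fun s hs => h0 _ fun h => ?_
    exact absurd h.1 (not_le.2 hs)
  rw [← intervalIntegral.integral_Iic_sub_Iic hint.integrableOn hint.integrableOn, e0, sub_zero,
    integral_Iic_eq_integral_Iio, ← integral_indicator measurableSet_Iio]
  simp only [Function.comp, convolution_def, ContinuousLinearMap.mul_apply']
  rw [← integral_sub_left_eq_self _ volume (x 0)]
  refine integral_congr_ae (Filter.Eventually.of_forall fun s => ?_)
  simp [Set.indicator_apply]

theorem abs_integral_le_integral_abs_unit {f : ℝ → ℝ} (hf : Continuous f) {x : ℝ}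
    (hx : x ∈ Set.Icc (0 : ℝ) 1) : |∫ t in (0 : ℝ)..x, f t| ≤ ∫ t in (0 : ℝ)..1, |f t| := by
  refine (intervalIntegral.abs_integral_le_integral_abs hx.1).trans ?_
  exact intervalIntegral.integral_mono_interval le_rfl hx.1 hx.2
    (Filter.Eventually.of_forall fun t => abs_nonneg _) (hf.abs.intervalIntegrable _ _)

/-- The Cauchy–Schwarz inequality on the unit interval. -/
theorem sq_integral_abs_le {f : ℝ → ℝ} (hf : Continuous f) :
    (∫ t in (0 : ℝ)..1, |f t|) ^ 2 ≤ ∫ t in (0 : ℝ)..1, f t ^ 2 := by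
  obtain ⟨a, ha⟩ : ∃ a, a = ∫ t in (0 : ℝ)..1, |f t| := ⟨_, rfl⟩
  have h : 0 ≤ ∫ t in (0 : ℝ)..1, (|f t| - a) ^ 2 :=
    intervalIntegral.integral_nonneg zero_le_one fun _ _ => sq_nonneg _
  have e : ∀ t, (|f t| - a) ^ 2 = f t ^ 2 - 2 * a * |f t| + a ^ 2 := fun t => by
    rw [sub_sq, sq_abs]; ring
  simp_rw [e] at h
  rw [intervalIntegral.integral_add (Continuous.intervalIntegrable (by fun_prop) _ _) (by simp),
    intervalIntegral.integral_sub (Continuous.intervalIntegrable (by fun_prop) _ _)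
      (Continuous.intervalIntegrable (by fun_prop) _ _),
    intervalIntegral.integral_const_mul, ← ha] at h
  simp at h
  rw [← ha]
  nlinarith

/-- Fubini's theorem on the unit square. -/
theorem setIntegral_unitSquare {f : Plane → ℝ} (hf : Continuous f) :
    ∫ x in interior unitSquare, f x
      = ∫ y in (0 : ℝ)..1, ∫ t in (0 : ℝ)..1, f !₂[t, y] := by
  have hm : MeasurePreserving (fun q : ℝ × ℝ => (!₂[q.1, q.2] : Plane)) volume volume :=
    (PiLp.volume_preserving_toLp (Fin 2)).comp (volume_preserving_finTwoArrow ℝ).symm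
  have hemb : MeasurableEmbedding (fun q : ℝ × ℝ => (!₂[q.1, q.2] : Plane)) :=
    (MeasurableEquiv.toLp 2 (Fin 2 → ℝ)).measurableEmbedding.comp
      (MeasurableEquiv.finTwoArrow (α := ℝ)).symm.measurableEmbedding
  rw [← hm.setIntegral_preimage_emb hemb]
  have hpre : (fun q : ℝ × ℝ => (!₂[q.1, q.2] : Plane)) ⁻¹' interior unitSquare
      = Set.Ioo (0 : ℝ) 1 ×ˢ Set.Ioo (0 : ℝ) 1 := by
    rw [interior_unitSquare]
    ext q
    simp [Fin.forall_fin_two]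
  have hcont : Continuous fun q : ℝ × ℝ => f !₂[q.1, q.2] := hf.comp continuous_vec2
  rw [hpre, Measure.volume_eq_prod, ← Measure.prod_restrict, integral_prod_symm]
  · simp only [intervalIntegral.integral_of_le zero_le_one, integral_Ioc_eq_integral_Ioo]
  · rw [Measure.prod_restrict]
    exact (hcont.continuousOn.integrableOn_compact (isCompact_Icc.prod isCompact_Icc)).mono_set
      (Set.prod_mono Set.Ioo_subset_Icc_self Set.Ioo_subset_Icc_self)

/-- The support of a test function on the open unit square keeps a distance from the boundary. -/
theorem IsTest.exists_margin {φ : Plane → ℝ} (hφ : IsTest (interior unitSquare) φ) :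
    ∃ δ : ℝ, 0 < δ ∧ δ ≤ 1 / 4 ∧ ∀ x : Plane, ∀ i, x i ∉ Set.Icc δ (1 - δ) → φ x = 0 := by
  have hc : ContinuousOn (fun x : Plane => min (min (x 0) (1 - x 0)) (min (x 1) (1 - x 1)))
      (tsupport φ) := by fun_prop
  obtain ⟨δ, hδ, h⟩ := hφ.2.isCompact.exists_forall_le' hc (a := 0) fun x hx => by
    have := hφ.3 hx
    rw [interior_unitSquare] at this
    have h0 := this 0
    have h1 := this 1
    simp only [lt_min_iff, sub_pos]
    exact ⟨h0, h1⟩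
  refine ⟨min δ (1 / 4), lt_min hδ (by norm_num), min_le_right _ _, fun x i hi => ?_⟩
  by_contra hne
  refine hi ?_
  have := h x (subset_tsupport _ hne)
  simp only [le_min_iff] at this
  have hmin := min_le_left δ (1 / 4)
  fin_cases i
  · exact ⟨by simpa using hmin.trans this.1.1, by simp only [Fin.zero_eta]; linarith⟩
  · exact ⟨by simpa using hmin.trans this.2.1, by simp only [Fin.mk_one]; linarith⟩

theorem isTest_of_margin {ψ : Plane → ℝ} (h : ContDiff ℝ ∞ ψ) {δ : ℝ} (hδ : 0 < δ)
    (h0 : ∀ x : Plane, ∀ i, x i ∉ Set.Icc δ (1 - δ) → ψ x = 0) :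
    IsTest (interior unitSquare) ψ := by
  have hcl : IsClosed {x : Plane | ∀ i, x i ∈ Set.Icc δ (1 - δ)} := by
    simp only [Set.ofPred_forall]
    exact isClosed_iInter fun i => isClosed_Icc.preimage (by fun_prop)
  have hsub : tsupport ψ ⊆ {x : Plane | ∀ i, x i ∈ Set.Icc δ (1 - δ)} := by
    refine closure_minimal (fun x hx => ?_) hcl
    by_contra hne
    obtain ⟨i, hi⟩ := not_forall.1 hne
    exact hx (h0 x i hi)
  refine ⟨h, ?_, hsub.trans ?_⟩
  · refine isCompact_unitSquare.of_isClosed_subset (isClosed_tsupport _) (hsub.trans ?_)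
    intro x hx i
    exact ⟨hδ.le.trans (hx i).1, (hx i).2.trans (by linarith)⟩
  · rw [interior_unitSquare]
    intro x hx i
    exact ⟨hδ.trans_le (hx i).1, (hx i).2.trans_lt (by linarith)⟩

/-- A smooth nonnegative bump function in the unit interval with integral one. -/
theorem exists_unit_bump : ∃ η : ℝ → ℝ, ContDiff ℝ ∞ η ∧ (∀ t, 0 ≤ η t) ∧
    (∀ t, t ∉ Set.Icc (1 / 4 : ℝ) (3 / 4) → η t = 0) ∧ ∫ t in (0 : ℝ)..1, η t = 1 := by
  let b : ContDiffBump (1 / 2 : ℝ) := ⟨1 / 8, 1 / 4, by norm_num, by norm_num⟩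
  have h0 : ∀ t, t ∉ Set.Icc (1 / 4 : ℝ) (3 / 4) → b.normed volume t = 0 := by
    intro t ht
    by_contra hne
    have : t ∈ Function.support (b.normed volume) := hne
    rw [b.support_normed_eq, Real.ball_eq_Ioo] at this
    refine ht ⟨?_, ?_⟩
    · have := this.1; norm_num [b] at this; linarith
    · have := this.2; norm_num [b] at this; linarith
  refine ⟨b.normed volume, b.contDiff_normed, b.nonneg_normed, h0, ?_⟩
  rw [intervalIntegral.integral_of_le zero_le_one]
  refine Eq.trans ?_ (b.integral_normed (μ := volume))
  refine setIntegral_eq_integral_of_forall_compl_eq_zero fun t ht => h0 t fun h => ht ?_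
  exact ⟨by linarith [h.1], by linarith [h.2]⟩

/-- Right inverse of the divergence on the unit square with compact supports: a test function
whose integral has been removed by a fixed bump is the divergence of a pair of test functions that
it controls in `L²`. -/
theorem exists_divergence_eq : ∃ χ : Plane → ℝ, ContDiff ℝ ∞ χ ∧ ∃ C : ℝ, 0 ≤ C ∧
    ∀ φ, IsTest (interior unitSquare) φ → ∃ ψ : Fin 2 → Plane → ℝ,
      (∀ i, IsTest (interior unitSquare) (ψ i)) ∧
      (∀ x, partialDeriv 0 (ψ 0) x + partialDeriv 1 (ψ 1) x
        = φ x - χ x * ∫ y in interior unitSquare, φ y) ∧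
      ∀ i, ∫ x in interior unitSquare, ψ i x ^ 2 ≤ C ^ 2 * ∫ x in interior unitSquare, φ x ^ 2 := by
  obtain ⟨η, hη, hη0, hηs, hη1⟩ := exists_unit_bump
  obtain ⟨H, hH⟩ : ∃ H, ∀ t, η t ≤ H := by
    obtain ⟨H, hH⟩ := (isCompact_Icc (a := (1 / 4 : ℝ)) (b := 3 / 4)).exists_bound_of_continuousOn
      hη.continuous.continuousOn
    refine ⟨max H 0, fun t => ?_⟩
    by_cases ht : t ∈ Set.Icc (1 / 4 : ℝ) (3 / 4)
    · exact (le_abs_self _).trans ((hH t ht).trans (le_max_left _ _))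
    · rw [hηs t ht]; exact le_max_right _ _
  have hH0 : 0 ≤ H := (hη0 0).trans (hH 0)
  -- the primitive of the bump climbs from `0` to `1`
  set E : ℝ → ℝ := fun x => ∫ t in (0 : ℝ)..x, η t with hE
  have hEs : ContDiff ℝ ∞ E := contDiff_primitive hη
  have hint : ∀ {k : ℝ → ℝ}, Continuous k → ∀ a b, IntervalIntegrable k volume a b :=
    fun hk a b => hk.intervalIntegrable a b
  have prim_left : ∀ {k : ℝ → ℝ} {δ x : ℝ}, 0 < δ → (∀ t, t ∉ Set.Icc δ (1 - δ) → k t = 0) →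
      x < δ → ∫ t in (0 : ℝ)..x, k t = 0 := by
    intro k δ x hδ hk hx
    refine intervalIntegral.integral_zero_ae
      (Filter.Eventually.of_forall fun t ht => hk t fun h => ?_)
    have : t ≤ max 0 x := ht.2
    exact absurd (h.1.trans this) (not_le.2 (max_lt hδ hx))
  have prim_right : ∀ {k : ℝ → ℝ} {δ x : ℝ}, Continuous k → 0 < δ →
      (∀ t, t ∉ Set.Icc δ (1 - δ) → k t = 0) →
      1 - δ < x → ∫ t in (0 : ℝ)..x, k t = ∫ t in (0 : ℝ)..1, k t := by
    intro k δ x hk hδ hk0 hx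
    rw [← intervalIntegral.integral_add_adjacent_intervals (hint hk 0 1) (hint hk 1 x)]
    refine add_eq_left.2 ?_
    refine intervalIntegral.integral_zero_ae
      (Filter.Eventually.of_forall fun t ht => hk0 t fun h => ?_)
    have : min 1 x < t := ht.1
    exact absurd (this.trans_le h.2) (not_lt.2 (le_min (by linarith) hx.le))
  have hE01 : ∀ x ∈ Set.Icc (0 : ℝ) 1, |E x| ≤ 1 := by
    intro x hx
    refine (abs_integral_le_integral_abs_unit hη.continuous hx).trans_eq ?_
    simp_rw [abs_of_nonneg (hη0 _)]
    exact hη1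
  refine ⟨fun x => η (x 0) * η (x 1), by fun_prop, 2 * (H + 1), by positivity, fun φ hφ => ?_⟩
  obtain ⟨δ, hδ, hδ4, hmargin⟩ := hφ.exists_margin
  have hηδ : ∀ t, t ∉ Set.Icc δ (1 - δ) → η t = 0 := fun t ht => hηs t fun h => ht
    ⟨hδ4.trans h.1, h.2.trans (by linarith)⟩
  have hφ2 : Continuous fun q : ℝ × ℝ => φ !₂[q.1, q.2] := hφ.1.continuous.comp continuous_vec2
  have hφy : ∀ y, Continuous fun t => φ !₂[t, y] := fun y =>
    hφ2.comp (continuous_id.prodMk continuous_const)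
  have hφm : ∀ y t, t ∉ Set.Icc δ (1 - δ) → φ !₂[t, y] = 0 := fun y t ht => hmargin !₂[t, y] 0 ht
  -- the marginal of `φ` in the second coordinate
  set m : ℝ → ℝ := fun y => ∫ t in (0 : ℝ)..1, φ !₂[t, y] with hm
  have hP := contDiff_partial_primitive hφ.1 fun x hx => hmargin x 0 fun h => hx
    ⟨hδ.le.trans h.1, h.2.trans (by linarith)⟩
  have hms : ContDiff ℝ ∞ m :=
    hP.comp (contDiff_vec2.comp ((contDiff_const (c := (1 : ℝ))).prodMk contDiff_id))
  have hmm : ∀ y, y ∉ Set.Icc δ (1 - δ) → m y = 0 := by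
    intro y hy
    simp only [hm]
    rw [intervalIntegral.integral_congr (g := fun _ => 0) fun t _ => hmargin !₂[t, y] 1 hy]
    simp
  have hI : ∫ y in interior unitSquare, φ y = ∫ y in (0 : ℝ)..1, m y :=
    setIntegral_unitSquare hφ.1.continuous
  set I := ∫ y in interior unitSquare, φ y with hIdef
  have hEη : ∀ x, HasDerivAt E (η x) x := fun x =>
    intervalIntegral.integral_hasDerivAt_right (hint hη.continuous _ _)
      (hη.continuous.stronglyMeasurableAtFilter _ _) hη.continuous.continuousAt
  -- the first component corrects `φ` to mean value zero on each horizontal line, the second one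
  -- corrects the mean values on those lines
  let ψ : Fin 2 → Plane → ℝ := fun i x =>
    if i = 0 then (∫ t in (0 : ℝ)..x 0, φ !₂[t, x 1]) - E (x 0) * m (x 1)
    else η (x 0) * ((∫ t in (0 : ℝ)..x 1, m t) - E (x 1) * I)
  have hs0 : ContDiff ℝ ∞ (ψ 0) := hP.sub (by fun_prop)
  have hs1 : ContDiff ℝ ∞ (ψ 1) := by
    have := contDiff_primitive hms
    refine ContDiff.mul (by fun_prop) (ContDiff.sub ?_ (by fun_prop))
    exact this.comp (by fun_prop : ContDiff ℝ ∞ fun x : Plane => x 1)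
  have ht0 : IsTest (interior unitSquare) (ψ 0) := by
    refine isTest_of_margin hs0 hδ fun x i hi => ?_
    simp only [ψ, if_true]
    fin_cases i
    · simp only [Fin.zero_eta, Set.mem_Icc, not_and_or, not_le] at hi
      rcases hi with hi | hi
      · rw [prim_left hδ (hφm _) hi, show E (x 0) = 0 from prim_left hδ hηδ hi]
        simp
      · rw [prim_right (hφy _) hδ (hφm _) hi,
          show E (x 0) = 1 from (prim_right hη.continuous hδ hηδ hi).trans hη1]
        simp [hm]
    · rw [show m (x 1) = 0 from hmm _ hi,
        intervalIntegral.integral_congr (g := fun _ => 0) fun t _ => hmargin !₂[t, x 1] 1 hi]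
      simp
  have ht1 : IsTest (interior unitSquare) (ψ 1) := by
    refine isTest_of_margin hs1 hδ fun x i hi => ?_
    simp only [ψ, one_ne_zero, if_false]
    fin_cases i
    · rw [show η (x 0) = 0 from hηδ _ hi, zero_mul]
    · simp only [Fin.mk_one, Set.mem_Icc, not_and_or, not_le] at hi
      rcases hi with hi | hi
      · rw [prim_left hδ hmm hi, show E (x 1) = 0 from prim_left hδ hηδ hi]
        simp
      · rw [prim_right hms.continuous hδ hmm hi,
          show E (x 1) = 1 from (prim_right hη.continuous hδ hηδ hi).trans hη1, hI]
        simp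
  refine ⟨ψ, fun i => ?_, fun x => ?_, fun i => ?_⟩
  · fin_cases i
    exacts [ht0, ht1]
  · have d0 : partialDeriv 0 (ψ 0) x = φ x - η (x 0) * m (x 1) := by
      refine partialDeriv_eq_of_hasDerivAt hs0 ?_
      have h1 : HasDerivAt (fun s => ∫ t in (0 : ℝ)..s, φ !₂[t, x 1]) (φ !₂[x 0 + 0, x 1])
          (x 0 + 0) :=
        intervalIntegral.integral_hasDerivAt_right (hint (hφy _) _ _)
          ((hφy _).stronglyMeasurableAtFilter _ _) (hφy _).continuousAt
      have h2 := (h1.sub ((hEη (x 0 + 0)).mul_const (m (x 1)))).comp_const_add (x 0) 0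
      rw [add_zero, vec2_eta] at h2
      simpa [ψ] using h2
    have d1 : partialDeriv 1 (ψ 1) x = η (x 0) * (m (x 1) - η (x 1) * I) := by
      refine partialDeriv_eq_of_hasDerivAt hs1 ?_
      have h1 : HasDerivAt (fun s => ∫ t in (0 : ℝ)..s, m t) (m (x 1 + 0)) (x 1 + 0) :=
        intervalIntegral.integral_hasDerivAt_right (hint hms.continuous _ _)
          (hms.continuous.stronglyMeasurableAtFilter _ _) hms.continuous.continuousAt
      have h2 := ((h1.sub ((hEη (x 1 + 0)).mul_const I)).const_mul (η (x 0))).comp_const_add (x 1) 0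
      rw [add_zero] at h2
      simpa [ψ] using h2
    rw [d0, d1]
    ring
  · -- both components are controlled by integrals of `φ` along horizontal lines
    set S : ℝ → ℝ := fun y => ∫ t in (0 : ℝ)..1, φ !₂[t, y] ^ 2 with hS
    have hcs : ∀ {k : Plane → ℝ}, Continuous k →
        Continuous fun y => ∫ t in (0 : ℝ)..1, k !₂[t, y] ^ 2 := by
      intro k hk
      have h2 : Continuous fun q : ℝ × ℝ => k !₂[q.2, q.1] ^ 2 :=
        (hk.comp (continuous_vec2.comp (continuous_snd.prodMk continuous_fst))).pow 2
      exact intervalIntegral.continuous_parametric_intervalIntegral_of_continuous'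
        (f := fun y t => k !₂[t, y] ^ 2) h2 0 1
    have hSc : Continuous S := hcs hφ.1.continuous
    have hSφ : ∫ x in interior unitSquare, φ x ^ 2 = ∫ y in (0 : ℝ)..1, S y :=
      setIntegral_unitSquare (hφ.1.continuous.pow 2)
    have hS0 : ∀ y, 0 ≤ S y := fun y =>
      intervalIntegral.integral_nonneg zero_le_one fun _ _ => sq_nonneg _
    have hS1 : 0 ≤ ∫ y in (0 : ℝ)..1, S y :=
      intervalIntegral.integral_nonneg zero_le_one fun y _ => hS0 y
    have hmono : ∀ {f g : ℝ → ℝ}, Continuous f → Continuous g →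
        (∀ t ∈ Set.Icc (0 : ℝ) 1, f t ≤ g t) → ∫ t in (0 : ℝ)..1, f t ≤ ∫ t in (0 : ℝ)..1, g t :=
      fun hf hg h => intervalIntegral.integral_mono_on zero_le_one (hint hf _ _) (hint hg _ _) h
    have bound : ∀ {k : ℝ → ℝ} {x : ℝ}, Continuous k → x ∈ Set.Icc (0 : ℝ) 1 →
        |(∫ t in (0 : ℝ)..x, k t) - E x * ∫ t in (0 : ℝ)..1, k t|
          ≤ 2 * ∫ t in (0 : ℝ)..1, |k t| := by
      intro k x hk hx
      refine (abs_sub _ _).trans ?_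
      rw [abs_mul]
      have b1 := abs_integral_le_integral_abs_unit hk hx
      have b2 := abs_integral_le_integral_abs_unit hk (Set.right_mem_Icc.2 zero_le_one)
      have b3 := mul_le_mul (hE01 x hx) b2 (abs_nonneg _) zero_le_one
      linarith
    have hmS : ∀ y, m y ^ 2 ≤ S y := by
      intro y
      have := abs_integral_le_integral_abs_unit (hφy y) (Set.right_mem_Icc.2 zero_le_one)
      exact (sq_le_sq' (abs_le.1 this).1 (abs_le.1 this).2).trans (sq_integral_abs_le (hφy y))
    have hψc : ∀ i, Continuous (ψ i) := fun i => by
      fin_cases i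
      exacts [hs0.continuous, hs1.continuous]
    have hline : ∀ i y, Continuous fun t => ψ i !₂[t, y] := fun i y =>
      (hψc i).comp (continuous_vec2.comp (continuous_id.prodMk continuous_const))
    have hT := hcs (hψc i)
    have hF : ∫ x in interior unitSquare, ψ i x ^ 2
        = ∫ y in (0 : ℝ)..1, ∫ t in (0 : ℝ)..1, ψ i !₂[t, y] ^ 2 :=
      setIntegral_unitSquare ((hψc i).pow 2)
    rw [hF, hSφ]
    fin_cases i
    · calc _ ≤ ∫ y in (0 : ℝ)..1, 4 * S y := by
            refine hmono hT (by fun_prop) fun y _ => ?_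
            refine (hmono ((hline 0 y).pow 2) (continuous_const (y := 4 * S y))
              fun t ht => ?_).trans_eq (by simp)
            have b := bound (hφy y) ht
            have b' : |ψ 0 !₂[t, y]| ≤ 2 * ∫ t in (0 : ℝ)..1, |φ !₂[t, y]| := b
            have b2 : (∫ t in (0 : ℝ)..1, |φ !₂[t, y]|) ^ 2 ≤ S y := sq_integral_abs_le (hφy y)
            refine (sq_le_sq' (abs_le.1 b').1 (abs_le.1 b').2).trans ?_
            linarith
        _ = 4 * ∫ y in (0 : ℝ)..1, S y := intervalIntegral.integral_const_mul _ _
        _ ≤ _ := by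
            refine mul_le_mul_of_nonneg_right ?_ hS1
            nlinarith
    · have hIm : (∫ t in (0 : ℝ)..1, |m t|) ^ 2 ≤ ∫ y in (0 : ℝ)..1, S y :=
        (sq_integral_abs_le hms.continuous).trans
          (hmono (hms.continuous.pow 2) hSc fun y _ => hmS y)
      have hm0 : 0 ≤ ∫ t in (0 : ℝ)..1, |m t| :=
        intervalIntegral.integral_nonneg zero_le_one fun _ _ => abs_nonneg _
      calc _ ≤ ∫ y in (0 : ℝ)..1, (4 * H ^ 2 * ∫ y in (0 : ℝ)..1, S y : ℝ) := by
            refine hmono hT continuous_const fun y hy => ?_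
            refine (hmono ((hline 1 y).pow 2)
              (continuous_const (y := 4 * H ^ 2 * ∫ y in (0 : ℝ)..1, S y))
              fun t _ => ?_).trans_eq (by simp)
            have b := bound hms.continuous hy
            have b' : |ψ 1 !₂[t, y]| ≤ H * (2 * ∫ t in (0 : ℝ)..1, |m t|) := by
              have e : ψ 1 !₂[t, y] = η t * ((∫ t in (0 : ℝ)..y, m t)
                  - E y * ∫ t in (0 : ℝ)..1, m t) := by
                simp [ψ, hI]
              rw [e, abs_mul, abs_of_nonneg (hη0 t)]
              exact mul_le_mul (hH t) b (abs_nonneg _) hH0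
            refine (sq_le_sq' (abs_le.1 b').1 (abs_le.1 b').2).trans ?_
            linarith [mul_le_mul_of_nonneg_left hIm (sq_nonneg H)]
        _ = 4 * H ^ 2 * ∫ y in (0 : ℝ)..1, S y := by simp
        _ ≤ _ := by
            refine mul_le_mul_of_nonneg_right ?_ hS1
            nlinarith

instance isFiniteMeasure_unitSquare :
    IsFiniteMeasure ((volume : Measure Plane).restrict (interior unitSquare)) :=
  ⟨by
    rw [Measure.restrict_apply_univ]
    exact (measure_mono interior_subset).trans_lt isCompact_unitSquare.measure_lt_top⟩

theorem memLp_of_continuous {f : Plane → ℝ} (hf : Continuous f) :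
    MemLp f 2 (volume.restrict (interior unitSquare)) := by
  obtain ⟨C, hC⟩ := isCompact_unitSquare.exists_bound_of_continuousOn hf.continuousOn
  refine MemLp.of_bound hf.aestronglyMeasurable C ?_
  rw [ae_restrict_iff' isOpen_interior.measurableSet]
  exact Filter.Eventually.of_forall fun x hx => hC x (interior_subset hx)

/-- The Poincaré inequality, by duality with the right inverse of the divergence. -/
theorem poincare_unitSquare : ∃ C : ℝ, 0 ≤ C ∧ ∀ f g₀ g₁ : Plane → ℝ,
    MemLp f 2 (volume.restrict (interior unitSquare)) →
    MemLp g₀ 2 (volume.restrict (interior unitSquare)) →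
    MemLp g₁ 2 (volume.restrict (interior unitSquare)) →
    WeakPartial (interior unitSquare) 0 f g₀ → WeakPartial (interior unitSquare) 1 f g₁ →
    ∃ c : ℝ, eLpNorm (fun x => f x - c) 2 (volume.restrict (interior unitSquare))
      ≤ ENNReal.ofReal C * (eLpNorm g₀ 2 (volume.restrict (interior unitSquare))
        + eLpNorm g₁ 2 (volume.restrict (interior unitSquare))) := by
  obtain ⟨χ, hχ, C, hC, h⟩ := exists_divergence_eq
  refine ⟨C, hC, fun f g₀ g₁ hf hg₀ hg₁ h₀ h₁ => ?_⟩
  set μ := volume.restrict (interior unitSquare) with hμ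
  refine ⟨∫ x, f x * χ x ∂μ, ?_⟩
  rw [← ENNReal.ofReal_toReal hg₀.2.ne, ← ENNReal.ofReal_toReal hg₁.2.ne,
    ← ENNReal.ofReal_add ENNReal.toReal_nonneg ENNReal.toReal_nonneg, ← ENNReal.ofReal_mul hC]
  refine eLpNorm_le_of_test isOpen_interior (hf.sub (memLp_const _)) fun φ hφ => ?_
  obtain ⟨ψ, hψ, hdiv, hψn⟩ := h φ hφ
  have hψn' : ∀ i, (eLpNorm (ψ i) 2 μ).toReal ≤ C * (eLpNorm φ 2 μ).toReal := by
    intro i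
    refine abs_le_of_sq_le_sq' ?_ (by positivity) |>.2
    rw [eLpNorm_toReal_sq ((hψ i).memLp μ), mul_pow, eLpNorm_toReal_sq (hφ.memLp μ)]
    exact hψn i
  have hχ2 : MemLp χ 2 μ := memLp_of_continuous hχ.continuous
  have e : ∫ x, (f x - ∫ x, f x * χ x ∂μ) * φ x ∂μ
      = -(∫ x, g₀ x * ψ 0 x ∂μ) - ∫ x, g₁ x * ψ 1 x ∂μ := by
    rw [sub_eq_add_neg, ← h₀ _ (hψ 0), ← h₁ _ (hψ 1),
      ← integral_add (((hψ 0).partialDeriv 0).integrable_mul hf)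
        (((hψ 1).partialDeriv 1).integrable_mul hf)]
    simp_rw [← mul_add, hdiv, mul_sub, sub_mul]
    have i1 := hφ.integrable_mul hf
    have i2 : Integrable φ μ := (hφ.memLp μ).integrable (by norm_num)
    have i3 : Integrable (fun x => f x * χ x) μ := hf.integrable_mul hχ2
    rw [integral_sub i1 (i2.const_mul _), integral_sub i1, integral_const_mul]
    · congr 1
      simp_rw [← mul_assoc]
      rw [integral_mul_const]
    · simp_rw [← mul_assoc]
      exact i3.mul_const _
  refine (congrArg abs e).trans_le ?_
  refine (abs_sub _ _).trans ?_
  rw [abs_neg]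
  have b0 := (abs_integral_mul_le hg₀ ((hψ 0).memLp μ)).trans
    (mul_le_mul_of_nonneg_left (hψn' 0) ENNReal.toReal_nonneg)
  have b1 := (abs_integral_mul_le hg₁ ((hψ 1).memLp μ)).trans
    (mul_le_mul_of_nonneg_left (hψn' 1) ENNReal.toReal_nonneg)
  refine (add_le_add b0 b1).trans_eq ?_
  ring

end QuadFE

/-! ### Polynomials and the Bramble–Hilbert lemma -/

namespace QuadFE

theorem polyFun_add (q q' : MvPolynomial (Fin 2) ℝ) :
    polyFun (q + q') = polyFun q + polyFun q' := by
  ext x; simp [polyFun]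

theorem polyFun_smul (c : ℝ) (q : MvPolynomial (Fin 2) ℝ) : polyFun (c • q) = c • polyFun q := by
  ext x; simp [polyFun]

theorem polyFun_C (a : ℝ) : polyFun (MvPolynomial.C a) = fun _ => a := by
  ext x; simp [polyFun]

theorem polyFun_mul_X (p : MvPolynomial (Fin 2) ℝ) (j : Fin 2) :
    polyFun (p * MvPolynomial.X j) = polyFun p * fun x : Plane => x j := by
  ext x; simp [polyFun]

theorem contDiff_polyFun (q : MvPolynomial (Fin 2) ℝ) : ContDiff ℝ ∞ (polyFun q) := by
  induction q using MvPolynomial.induction_on with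
  | C a => rw [polyFun_C]; exact contDiff_const
  | add p q hp hq => rw [polyFun_add]; exact hp.add hq
  | mul_X p i hp =>
    rw [polyFun_mul_X]
    exact hp.mul (by fun_prop)

theorem polyFun_zero : polyFun 0 = 0 := by
  ext x; simp [polyFun]

theorem partialDeriv_polyFun (q : MvPolynomial (Fin 2) ℝ) (i : Fin 2) :
    partialDeriv i (polyFun q) = polyFun (MvPolynomial.pderiv i q) := by
  induction q using MvPolynomial.induction_on with
  | C a =>
    rw [polyFun_C, MvPolynomial.pderiv_C, polyFun_zero]
    ext x
    simp [partialDeriv]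
  | add p q hp hq =>
    rw [polyFun_add, partialDeriv_add (contDiff_polyFun p) (contDiff_polyFun q), hp, hq, map_add,
      polyFun_add]
  | mul_X p j hp =>
    have hj : ContDiff ℝ ∞ fun x : Plane => x j := by fun_prop
    have hd : partialDeriv i (fun x : Plane => x j) = fun _ => if j = i then 1 else 0 := by
      ext x
      have : HasFDerivAt (fun x : Plane => x j) (EuclideanSpace.proj (𝕜 := ℝ) j) x :=
        (EuclideanSpace.proj (𝕜 := ℝ) j).hasFDerivAt
      rw [partialDeriv, this.fderiv]
      simp
    rw [polyFun_mul_X, partialDeriv_mul (contDiff_polyFun p) hj, hp, hd]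
    ext x
    simp only [polyFun, MvPolynomial.pderiv_mul, MvPolynomial.pderiv_X, Pi.add_apply, Pi.mul_apply,
      map_add, map_mul, MvPolynomial.eval_X]
    by_cases h : j = i
    · subst h; simp; ring
    · simp [h]

/-- The derivative of a polynomial with multi-index `α`. -/
noncomputable def polyDeriv (α : ℕ × ℕ) : Module.End ℝ (MvPolynomial (Fin 2) ℝ) :=
  (MvPolynomial.pderiv (R := ℝ) (0 : Fin 2)).toLinearMap ^ α.1
    * (MvPolynomial.pderiv (R := ℝ) (1 : Fin 2)).toLinearMap ^ α.2

theorem commute_pderiv : Commute (MvPolynomial.pderiv (R := ℝ) (0 : Fin 2)).toLinearMap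
    (MvPolynomial.pderiv (R := ℝ) (1 : Fin 2)).toLinearMap := by
  have h : ⁅MvPolynomial.pderiv (R := ℝ) (0 : Fin 2), MvPolynomial.pderiv (R := ℝ) (1 : Fin 2)⁆
      = 0 := by
    refine MvPolynomial.derivation_ext fun i => ?_
    fin_cases i <;> simp [Derivation.commutator_apply, MvPolynomial.pderiv_X]
  refine LinearMap.ext fun q => ?_
  have := congrArg (fun D => D q) h
  simp only [Derivation.commutator_apply, Derivation.zero_apply, sub_eq_zero] at this
  exact this

theorem polyDeriv_zero (q : MvPolynomial (Fin 2) ℝ) : polyDeriv (0, 0) q = q := by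
  simp [polyDeriv]

theorem polyDeriv_add_unitIndex (α : ℕ × ℕ) (i : Fin 2) (q : MvPolynomial (Fin 2) ℝ) :
    polyDeriv (α + unitIndex i) q = MvPolynomial.pderiv i (polyDeriv α q) := by
  fin_cases i
  · simp [polyDeriv, unitIndex, pow_succ']
  · have h := (commute_pderiv.pow_left α.1).eq
    have := congrArg
      (fun D => D (((MvPolynomial.pderiv (R := ℝ) (1 : Fin 2)).toLinearMap ^ α.2) q)) h
    simpa [polyDeriv, unitIndex, pow_succ'] using this

theorem pderiv_pow_monomial (i : Fin 2) (n : ℕ) (s : Fin 2 →₀ ℕ) (a : ℝ) :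
    ((MvPolynomial.pderiv (R := ℝ) i).toLinearMap ^ n) (MvPolynomial.monomial s a)
      = MvPolynomial.monomial (s - Finsupp.single i n) (a * (s i).descFactorial n) := by
  induction n with
  | zero => simp
  | succ n ih =>
    rw [pow_succ', Module.End.mul_apply, ih]
    simp only [Derivation.coeFn_coe, MvPolynomial.pderiv_monomial]
    congr 1
    · congr 1
      ext j
      by_cases h : i = j
      · subst h; simp; omega
      · simp [h]
    · simp [Nat.descFactorial_succ]
      ring

theorem polyDeriv_monomial (α : ℕ × ℕ) (s : Fin 2 →₀ ℕ) (a : ℝ) :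
    polyDeriv α (MvPolynomial.monomial s a)
      = MvPolynomial.monomial (s - Finsupp.single 1 α.2 - Finsupp.single 0 α.1)
        (a * (s 1).descFactorial α.2 * (s 0).descFactorial α.1) := by
  rw [polyDeriv, Module.End.mul_apply, pderiv_pow_monomial, pderiv_pow_monomial]
  congr 2
  simp

theorem polyDeriv_eq_zero {q : MvPolynomial (Fin 2) ℝ} {α : ℕ × ℕ}
    (h : q.totalDegree < α.1 + α.2) : polyDeriv α q = 0 := by
  rw [← MvPolynomial.support_sum_monomial_coeff q, map_sum]
  refine Finset.sum_eq_zero fun s hs => ?_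
  have hle := MvPolynomial.le_totalDegree hs
  rw [Finsupp.sum_fintype _ _ (fun _ => rfl), Fin.sum_univ_two] at hle
  rw [polyDeriv_monomial]
  have : s 1 < α.2 ∨ s 0 < α.1 := by omega
  rcases this with h | h <;> simp [Nat.descFactorial_eq_zero_iff_lt.2 h]

/-- Polynomials of degree at most `n` may have any prescribed derivatives of order `n`. -/
theorem exists_polyDeriv_eq (n : ℕ) (c : ℕ × ℕ → ℝ) : ∃ q : MvPolynomial (Fin 2) ℝ,
    q.totalDegree ≤ n ∧ ∀ α : ℕ × ℕ, α.1 + α.2 = n → polyDeriv α q = MvPolynomial.C (c α) := by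
  classical
  let s : ℕ × ℕ → Fin 2 →₀ ℕ := fun β => Finsupp.single 0 β.1 + Finsupp.single 1 β.2
  have s0 : ∀ β, s β 0 = β.1 := fun β => by simp [s]
  have s1 : ∀ β, s β 1 = β.2 := fun β => by simp [s]
  refine ⟨∑ β ∈ Finset.HasAntidiagonal.antidiagonal n,
    MvPolynomial.monomial (s β) (c β / (β.1.factorial * β.2.factorial)), ?_, fun α hα => ?_⟩
  · refine (MvPolynomial.totalDegree_finsetSum _ _).trans (Finset.sup_le fun β hβ => ?_)
    refine (MvPolynomial.totalDegree_monomial_le _ _).trans ?_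
    rw [Finsupp.sum_fintype _ _ (fun _ => rfl), Fin.sum_univ_two, s0, s1]
    exact (Finset.HasAntidiagonal.mem_antidiagonal.1 hβ).le
  · rw [map_sum, Finset.sum_eq_single α]
    · rw [polyDeriv_monomial, s0, s1, Nat.descFactorial_self, Nat.descFactorial_self,
        show s α - Finsupp.single 1 α.2 - Finsupp.single 0 α.1 = 0 by
          ext j; fin_cases j <;> simp [s]]
      rw [MvPolynomial.C_apply]
      congr 1
      have h1 := Nat.factorial_ne_zero α.1
      have h2 := Nat.factorial_ne_zero α.2
      field_simp
    · intro β hβ hne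
      have hβ' := Finset.HasAntidiagonal.mem_antidiagonal.1 hβ
      rw [polyDeriv_monomial, s0, s1]
      have : β.2 < α.2 ∨ β.1 < α.1 := by
        by_contra hcon
        refine hne (Prod.ext ?_ ?_) <;> omega
      rcases this with h | h <;> simp [Nat.descFactorial_eq_zero_iff_lt.2 h]
    · intro h
      exact absurd (Finset.HasAntidiagonal.mem_antidiagonal.2 hα) h

/-- A family `d` of square integrable functions on the open unit square, indexed by the
multi-indices of order at most `m`, in which each is a weak derivative of the preceding ones. -/
structure IsJet (m : ℕ) (d : ℕ × ℕ → Plane → ℝ) : Prop where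
  memLp : ∀ α : ℕ × ℕ, α.1 + α.2 ≤ m → MemLp (d α) 2 (volume.restrict (interior unitSquare))
  weakPartial : ∀ (α : ℕ × ℕ) (i : Fin 2), α.1 + α.2 < m →
    WeakPartial (interior unitSquare) i (d α) (d (α + unitIndex i))

theorem memLp_polyFun (q : MvPolynomial (Fin 2) ℝ) :
    MemLp (polyFun q) 2 (volume.restrict (interior unitSquare)) :=
  memLp_of_continuous (contDiff_polyFun q).continuous

theorem WeakPartial.sub {U : Set Plane} {i : Fin 2} {v g w k : Plane → ℝ}
    (h : WeakPartial U i v g) (h' : WeakPartial U i w k) (hv : MemLp v 2 (volume.restrict U))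
    (hw : MemLp w 2 (volume.restrict U)) (hg : MemLp g 2 (volume.restrict U))
    (hk : MemLp k 2 (volume.restrict U)) : WeakPartial U i (v - w) (g - k) := by
  intro φ hφ
  simp only [Pi.sub_apply, sub_mul]
  rw [integral_sub ((hφ.partialDeriv i).integrable_mul hv) ((hφ.partialDeriv i).integrable_mul hw),
    integral_sub (hφ.integrable_mul hg) (hφ.integrable_mul hk), h φ hφ, h' φ hφ]
  ring

theorem weakPartial_polyFun (U : Set Plane) (i : Fin 2) (q : MvPolynomial (Fin 2) ℝ) :
    WeakPartial U i (polyFun q) (polyFun (MvPolynomial.pderiv i q)) := by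
  rw [← partialDeriv_polyFun]
  exact weakPartial_of_contDiff U i (contDiff_polyFun q)

theorem IsJet.sub_polyFun {m : ℕ} {d : ℕ × ℕ → Plane → ℝ} (h : IsJet m d)
    (q : MvPolynomial (Fin 2) ℝ) : IsJet m fun α => d α - polyFun (polyDeriv α q) where
  memLp α hα := (h.memLp α hα).sub (memLp_polyFun _)
  weakPartial α i hα := by
    rw [polyDeriv_add_unitIndex]
    exact (h.weakPartial α i hα).sub (weakPartial_polyFun _ i _) (h.memLp α hα.le)
      (memLp_polyFun _) (h.memLp _ (by rw [unitIndex_add_sum]; omega)) (memLp_polyFun _)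

/-- The Bramble–Hilbert lemma for jets. The induction removes the mean values of the derivatives
of highest order by a polynomial and applies the Poincaré inequality to them. -/
theorem IsJet.exists_polynomial (r : ℕ) : ∃ C : NNReal, ∀ d : ℕ × ℕ → Plane → ℝ,
    IsJet (r + 1) d → ∀ A : ℝ≥0∞, (∀ α : ℕ × ℕ, α.1 + α.2 = r + 1 →
      eLpNorm (d α) 2 (volume.restrict (interior unitSquare)) ≤ A) →
    ∃ q : MvPolynomial (Fin 2) ℝ, q.totalDegree ≤ r ∧ ∀ α : ℕ × ℕ, α.1 + α.2 ≤ r →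
      eLpNorm (d α - polyFun (polyDeriv α q)) 2 (volume.restrict (interior unitSquare))
        ≤ C * A := by
  obtain ⟨P, hP, hpoin⟩ := poincare_unitSquare
  -- subtract a polynomial of degree `n` so that the derivatives of order `n` become small
  have top : ∀ (n : ℕ) (d : ℕ × ℕ → Plane → ℝ), IsJet (n + 1) d → ∀ A : ℝ≥0∞,
      (∀ α : ℕ × ℕ, α.1 + α.2 = n + 1 →
        eLpNorm (d α) 2 (volume.restrict (interior unitSquare)) ≤ A) →
      ∃ q : MvPolynomial (Fin 2) ℝ, q.totalDegree ≤ n ∧ ∀ α : ℕ × ℕ, α.1 + α.2 = n →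
        eLpNorm (d α - polyFun (polyDeriv α q)) 2 (volume.restrict (interior unitSquare))
          ≤ (P.toNNReal * 2 : NNReal) * A := by
    intro n d hd A hA
    have key : ∀ α : ℕ × ℕ, ∃ c : ℝ, α.1 + α.2 = n →
        eLpNorm (fun x => d α x - c) 2 (volume.restrict (interior unitSquare))
          ≤ (P.toNNReal * 2 : NNReal) * A := by
      intro α
      by_cases hα : α.1 + α.2 = n
      · have h1 : ∀ i, (α + unitIndex i).1 + (α + unitIndex i).2 = n + 1 := fun i => by
          rw [unitIndex_add_sum, hα]
        obtain ⟨c, hc⟩ := hpoin (d α) _ _ (hd.memLp α (by omega)) (hd.memLp _ (h1 0).le)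
          (hd.memLp _ (h1 1).le) (hd.weakPartial α 0 (by omega)) (hd.weakPartial α 1 (by omega))
        refine ⟨c, fun _ => hc.trans ?_⟩
        rw [ENNReal.coe_mul, mul_assoc]
        refine mul_le_mul_right ((add_le_add (hA _ (h1 0)) (hA _ (h1 1))).trans_eq ?_) _
        simp [two_mul]
      · exact ⟨0, fun h => absurd h hα⟩
    choose c hc using key
    obtain ⟨q, hq, hqc⟩ := exists_polyDeriv_eq n c
    refine ⟨q, hq, fun α hα => ?_⟩
    rw [hqc α hα]
    convert hc α hα using 2
    ext x
    simp [polyFun]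
  induction r with
  | zero =>
    refine ⟨P.toNNReal * 2, fun d hd A hA => ?_⟩
    obtain ⟨q, hq, h⟩ := top 0 d hd A hA
    exact ⟨q, hq, fun α hα => h α (Nat.le_zero.1 hα)⟩
  | succ r ih =>
    obtain ⟨C, hC⟩ := ih
    refine ⟨max (P.toNNReal * 2) (C * (P.toNNReal * 2)), fun d hd A hA => ?_⟩
    obtain ⟨q₁, hq₁, h₁⟩ := top (r + 1) d hd A hA
    have hd' := hd.sub_polyFun q₁
    obtain ⟨q₂, hq₂, h₂⟩ := hC _ ⟨fun α hα => hd'.memLp α (by omega),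
      fun α i hα => hd'.weakPartial α i (by omega)⟩ _ h₁
    refine ⟨q₁ + q₂, (MvPolynomial.totalDegree_add _ _).trans (max_le hq₁ (by omega)),
      fun α hα => ?_⟩
    rcases hα.lt_or_eq with hα | hα
    · rw [map_add, polyFun_add, ← sub_sub]
      refine (h₂ α (by omega)).trans ?_
      rw [← mul_assoc]
      gcongr
      rw [← ENNReal.coe_mul]
      exact_mod_cast le_max_right _ _
    · rw [map_add, polyDeriv_eq_zero (q := q₂) (by omega), add_zero]
      refine (h₁ α hα).trans ?_
      gcongr
      exact le_max_left _ _

theorem HasWeakDeriv.trans_weakPartial {U : Set Plane} {α : ℕ × ℕ} {v g k : Plane → ℝ} {i : Fin 2}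
    (h : HasWeakDeriv U α v g) (h' : WeakPartial U i g k) :
    HasWeakDeriv U (α + unitIndex i) v k := by
  rw [hasWeakDeriv_iff] at h ⊢
  intro φ hφ
  rw [← multiDeriv_partialDeriv hφ.1, h _ (hφ.partialDeriv i), h' φ hφ, unitIndex_add_sum]
  ring

theorem hasWeakDeriv_polyFun (U : Set Plane) (q : MvPolynomial (Fin 2) ℝ) (a b : ℕ) :
    HasWeakDeriv U (a, b) (polyFun q) (polyFun (polyDeriv (a, b) q)) := by
  induction a with
  | zero =>
    induction b with
    | zero => rw [polyDeriv_zero]; exact hasWeakDeriv_zero U _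
    | succ b ih =>
      have := ih.trans_weakPartial (weakPartial_polyFun U 1 _)
      rwa [← polyDeriv_add_unitIndex] at this
  | succ a ih =>
    have := ih.trans_weakPartial (weakPartial_polyFun U 0 _)
    rwa [← polyDeriv_add_unitIndex] at this

theorem HasWeakDeriv.sub {U : Set Plane} {α : ℕ × ℕ} {v g w k : Plane → ℝ}
    (h : HasWeakDeriv U α v g) (h' : HasWeakDeriv U α w k) (hv : MemLp v 2 (volume.restrict U))
    (hw : MemLp w 2 (volume.restrict U)) (hg : MemLp g 2 (volume.restrict U))
    (hk : MemLp k 2 (volume.restrict U)) : HasWeakDeriv U α (v - w) (g - k) := by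
  rw [hasWeakDeriv_iff] at h h' ⊢
  intro φ hφ
  simp only [Pi.sub_apply, sub_mul]
  rw [integral_sub ((hφ.multiDeriv α).integrable_mul hv) ((hφ.multiDeriv α).integrable_mul hw),
    integral_sub (hφ.integrable_mul hg) (hφ.integrable_mul hk), h φ hφ, h' φ hφ]
  ring

/-- The Bramble–Hilbert lemma on the unit square: modulo polynomials of degree at most `r`,
the full norm of order `r + 1` is controlled by the derivatives of order `r + 1`. -/
theorem bramble_hilbert (r : ℕ) : ∃ C : NNReal, ∀ (w : Plane → ℝ) (A : ℕ → ℝ≥0∞),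
    WeakBound (r + 1) (interior unitSquare) w A →
    ∃ q : MvPolynomial (Fin 2) ℝ, q.totalDegree ≤ r ∧
      MemSobolev (r + 1) (interior unitSquare) (w - polyFun q) ∧
      sobolevNorm (r + 1) (interior unitSquare) (w - polyFun q) ≤ C * A (r + 1) := by
  obtain ⟨C, hC⟩ := IsJet.exists_polynomial r
  refine ⟨((r + 1 + 1) ^ 2 : ℕ) * max C 1, fun w A hw => ?_⟩
  choose! d hd hdL hdA using fun α : ℕ × ℕ => hw.exists_hasWeakDeriv α.1 α.2
  have hjet : IsJet (r + 1) d := ⟨hdL, fun α i hα =>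
    (hd α hα.le).weakPartial (hd (α + unitIndex i) (by rw [unitIndex_add_sum]; omega))⟩
  obtain ⟨q, hq, h⟩ := hC d hjet (A (r + 1)) fun α hα => by
    have := hdA α hα.le
    rwa [hα] at this
  have hdq : ∀ α : ℕ × ℕ, α.1 + α.2 ≤ r + 1 → HasWeakDeriv (interior unitSquare) α
      (w - polyFun q) (d α - polyFun (polyDeriv α q)) := fun α hα =>
    (hd α hα).sub (hasWeakDeriv_polyFun _ q α.1 α.2) hw.memLp (memLp_polyFun q) (hdL α hα)
      (memLp_polyFun _)
  have hdqL : ∀ α : ℕ × ℕ, α.1 + α.2 ≤ r + 1 → MemLp (d α - polyFun (polyDeriv α q)) 2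
      (volume.restrict (interior unitSquare)) := fun α hα => (hdL α hα).sub (memLp_polyFun _)
  refine ⟨q, hq, ⟨hw.memLp.sub (memLp_polyFun q), fun α hα => ⟨_, hdqL α hα, hdq α hα⟩⟩, ?_⟩
  refine (sobolevNorm_le (A := (max C 1 : NNReal) * A (r + 1)) fun α hα => ?_).trans_eq ?_
  · rw [(hdq α hα).eLpNorm_weakDeriv isOpen_interior (hdqL α hα)]
    rcases hα.lt_or_eq with hα | hα
    · refine (h α (by omega)).trans ?_
      gcongr
      exact le_max_left _ _
    · rw [polyDeriv_eq_zero (q := q) (α := α) (by omega), polyFun_zero, sub_zero]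
      have h1 := hdA α hα.le
      rw [hα] at h1
      refine h1.trans (le_mul_of_one_le_left zero_le ?_)
      exact_mod_cast le_max_right _ _
  · push_cast
    ring

end QuadFE

/-! ### Change of variables by the bilinear map -/

namespace QuadFE

/-- The image of the open unit square under the bilinear map. -/
def openElement (p : Fin 4 → Plane) : Set Plane := bilinearMap p '' interior unitSquare

theorem openElement_subset_element (p : Fin 4 → Plane) : openElement p ⊆ element p :=
  Set.image_mono interior_subset

theorem measurableSet_interior_unitSquare : MeasurableSet (interior unitSquare) :=
  isOpen_interior.measurableSet

theorem contDiff_tangent_apply (p : Fin 4 → Plane) (j i : Fin 2) :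
    ContDiff ℝ ∞ fun x => tangent p j x i :=
  contDiff_euclidean.1 (contDiff_tangent p j) i

theorem contDiff_jac (p : Fin 4 → Plane) : ContDiff ℝ ∞ (jac p) :=
  ((contDiff_tangent_apply p 0 0).mul (contDiff_tangent_apply p 1 1)).sub
    ((contDiff_tangent_apply p 0 1).mul (contDiff_tangent_apply p 1 0))

section Convex

variable {p : Fin 4 → Plane}

theorem IsConvexQuad.injOn_interior (hp : IsConvexQuad p) :
    Set.InjOn (bilinearMap p) (interior unitSquare) :=
  hp.injOn.mono interior_subset

theorem hasFDerivWithinAt_bilinearMap (p : Fin 4 → Plane) (s : Set Plane) :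
    ∀ x ∈ s, HasFDerivWithinAt (bilinearMap p) (bilinearDeriv p x) s x :=
  fun x _ => (hasFDerivAt_bilinearMap p x).hasFDerivWithinAt

/-- The derivative of the bilinear map as an invertible map. -/
noncomputable def bilinearEquiv (p : Fin 4 → Plane) (x : Plane) (h : jac p x ≠ 0) :
    Plane ≃L[ℝ] Plane :=
  (bilinearDeriv p x).toContinuousLinearEquivOfDetNeZero (by rwa [det_fderiv_bilinearMap])

theorem hasFDerivAt_bilinearEquiv (p : Fin 4 → Plane) (x : Plane) (h : jac p x ≠ 0) :
    HasFDerivAt (bilinearMap p) (bilinearEquiv p x h : Plane →L[ℝ] Plane) x := by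
  have := hasFDerivAt_bilinearMap p x
  rwa [← (bilinearDeriv p x).coe_toContinuousLinearEquivOfDetNeZero
    (by rwa [det_fderiv_bilinearMap])] at this

theorem hasStrictFDerivAt_bilinearEquiv (p : Fin 4 → Plane) (x : Plane) (h : jac p x ≠ 0) :
    HasStrictFDerivAt (bilinearMap p) (bilinearEquiv p x h : Plane →L[ℝ] Plane) x :=
  (contDiff_bilinearMap p).contDiffAt.hasStrictFDerivAt' (hasFDerivAt_bilinearEquiv p x h)
    (by simp)

theorem IsConvexQuad.isOpen_openElement (hp : IsConvexQuad p) : IsOpen (openElement p) := by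
  rw [isOpen_iff_mem_nhds]
  rintro _ ⟨x, hx, rfl⟩
  rw [← (hasStrictFDerivAt_bilinearEquiv p x
    (hp.jac_ne_zero (interior_subset hx))).map_nhds_eq_of_equiv]
  exact Filter.image_mem_map (isOpen_interior.mem_nhds hx)

theorem IsConvexQuad.openElement_subset (hp : IsConvexQuad p) :
    openElement p ⊆ interior (element p) :=
  interior_maximal (openElement_subset_element p) hp.isOpen_openElement

theorem volume_unitSquare_diff_interior : volume (unitSquare \ interior unitSquare) = 0 := by
  have hc : Convex ℝ unitSquare := by
    intro x hx y hy a b ha hb hab i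
    exact convex_Icc (0 : ℝ) 1 (hx i) (hy i) ha hb hab
  refine measure_mono_null ?_ (hc.addHaar_frontier volume)
  rw [frontier]
  exact Set.sdiff_subset_sdiff_left subset_closure

theorem restrict_interior_unitSquare :
    (volume : Measure Plane).restrict (interior unitSquare) = volume.restrict unitSquare := by
  refine Measure.restrict_congr_set (ae_eq_set.2 ⟨?_, volume_unitSquare_diff_interior⟩)
  rw [Set.sdiff_eq_empty.2 interior_subset, measure_empty]

/-- The boundary of an element is a null set. -/
theorem restrict_openElement (p : Fin 4 → Plane) :
    (volume : Measure Plane).restrict (openElement p) = volume.restrict (element p) := by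
  refine Measure.restrict_congr_set (ae_eq_set.2 ⟨?_, ?_⟩)
  · rw [Set.sdiff_eq_empty.2 (openElement_subset_element p), measure_empty]
  · refine measure_mono_null (t := bilinearMap p '' (unitSquare \ interior unitSquare)) ?_
      (addHaar_image_eq_zero_of_differentiableOn_of_addHaar_eq_zero volume ?_
        volume_unitSquare_diff_interior)
    · rintro _ ⟨⟨x, hx, rfl⟩, h⟩
      exact ⟨x, ⟨hx, fun h' => h ⟨x, h', rfl⟩⟩, rfl⟩
    exact fun x _ => (hasFDerivAt_bilinearMap p x).differentiableAt.differentiableWithinAt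

/-- A test function on the open unit square is the pullback of a test function on the element. -/
theorem IsConvexQuad.exists_pushforward (hp : IsConvexQuad p) {χ : Plane → ℝ}
    (hχ : IsTest (interior unitSquare) χ) :
    ∃ ψ, IsTest (openElement p) ψ ∧ ∀ x ∈ interior unitSquare, ψ (bilinearMap p x) = χ x := by
  classical
  set G := Function.invFunOn (bilinearMap p) (interior unitSquare) with hG
  have hGF : ∀ x ∈ interior unitSquare, G (bilinearMap p x) = x := fun x hx =>
    hp.injOn_interior.leftInvOn_invFunOn hx
  set ψ : Plane → ℝ := (openElement p).indicator (χ ∘ G) with hψ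
  have hψF : ∀ x ∈ interior unitSquare, ψ (bilinearMap p x) = χ x := fun x hx => by
    rw [hψ, openElement, Set.indicator_of_mem (Set.mem_image_of_mem _ hx), Function.comp, hGF x hx]
  have hK : IsCompact (bilinearMap p '' tsupport χ) :=
    hχ.2.isCompact.image (contDiff_bilinearMap p).continuous
  have hψ0 : ∀ y, y ∉ bilinearMap p '' tsupport χ → ψ y = 0 := by
    intro y hy
    by_cases hyU : y ∈ openElement p
    · obtain ⟨x, hx, rfl⟩ := hyU
      rw [hψF x hx]
      exact image_eq_zero_of_notMem_tsupport fun h => hy ⟨x, h, rfl⟩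
    · exact Set.indicator_of_notMem hyU _
  have hsupp : tsupport ψ ⊆ bilinearMap p '' tsupport χ :=
    closure_minimal (fun y hy => by_contra fun h => hy (hψ0 y h)) hK.isClosed
  refine ⟨ψ, ⟨contDiff_iff_contDiffAt.2 fun y => ?_,
    hK.of_isClosed_subset (isClosed_tsupport _) hsupp,
    hsupp.trans (Set.image_mono hχ.3)⟩, hψF⟩
  by_cases hy : y ∈ bilinearMap p '' tsupport χ
  · obtain ⟨x, hx, rfl⟩ := hy
    have hxQ := hχ.3 hx
    have hJ := hp.jac_ne_zero (interior_subset hxQ)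
    -- the inverse of the bilinear map is smooth by the inverse function theorem
    have hloc := (hasStrictFDerivAt_bilinearEquiv p x hJ).localInverse_unique (g := G)
      (Filter.eventually_of_mem (isOpen_interior.mem_nhds hxQ) hGF)
    have hGs : ContDiffAt ℝ ∞ G (bilinearMap p x) :=
      ((contDiff_bilinearMap p).contDiffAt.to_localInverse (hasFDerivAt_bilinearEquiv p x hJ)
        (by simp)).congr_of_eventuallyEq hloc
    refine (ContDiffAt.comp _ hχ.1.contDiffAt hGs).congr_of_eventuallyEq ?_
    filter_upwards [hp.isOpen_openElement.mem_nhds (Set.mem_image_of_mem _ hxQ)] with y hy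
    exact Set.indicator_of_mem hy _
  · refine (contDiffAt_const (c := (0 : ℝ))).congr_of_eventuallyEq ?_
    filter_upwards [hK.isClosed.isOpen_compl.mem_nhds hy] with z hz
    exact hψ0 z hz

theorem IsConvexQuad.setIntegral_openElement (hp : IsConvexQuad p) (g : Plane → ℝ) :
    ∫ y in openElement p, g y
      = ∫ x in interior unitSquare, |jac p x| * g (bilinearMap p x) := by
  rw [openElement, integral_image_eq_integral_abs_det_fderiv_smul volume
    measurableSet_interior_unitSquare (hasFDerivWithinAt_bilinearMap p _) hp.injOn_interior]
  simp only [det_fderiv_bilinearMap, smul_eq_mul]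

theorem IsConvexQuad.setLIntegral_openElement (hp : IsConvexQuad p) (g : Plane → ℝ≥0∞) :
    ∫⁻ y in openElement p, g y
      = ∫⁻ x in interior unitSquare, ENNReal.ofReal |jac p x| * g (bilinearMap p x) := by
  rw [openElement, lintegral_image_eq_lintegral_abs_det_fderiv_mul volume
    measurableSet_interior_unitSquare (hasFDerivWithinAt_bilinearMap p _) hp.injOn_interior]
  simp only [det_fderiv_bilinearMap]

theorem eLpNorm_two_sq {μ : Measure Plane} (f : Plane → ℝ) :
    eLpNorm f 2 μ ^ 2 = ∫⁻ x, ‖f x‖ₑ ^ 2 ∂μ := by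
  have := eLpNorm_nnreal_pow_eq_lintegral (μ := μ) (f := f) (p := 2) (by norm_num)
  simp only [NNReal.coe_ofNat, ENNReal.coe_ofNat, ENNReal.rpow_ofNat] at this
  exact this

/-- The change of variables in `L²`, where the Jacobian determinant is bounded below. -/
theorem IsConvexQuad.eLpNorm_comp_le (hp : IsConvexQuad p) {δ : ℝ} (hδ : 0 ≤ δ)
    (h : ∀ x ∈ unitSquare, δ ^ 2 ≤ |jac p x|) (g : Plane → ℝ) :
    ENNReal.ofReal δ * eLpNorm (fun x => g (bilinearMap p x)) 2
        (volume.restrict (interior unitSquare))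
      ≤ eLpNorm g 2 (volume.restrict (openElement p)) := by
  rw [← ENNReal.pow_le_pow_left_iff (n := 2) (by norm_num), mul_pow, eLpNorm_two_sq,
    eLpNorm_two_sq, hp.setLIntegral_openElement, ← ENNReal.ofReal_pow hδ,
    ← lintegral_const_mul' _ _ ENNReal.ofReal_ne_top]
  refine setLIntegral_mono' measurableSet_interior_unitSquare fun x hx => ?_
  gcongr
  exact h x (interior_subset hx)

/-- The change of variables in `L²`, with the upper bound of the Jacobian determinant by `h ^ 2`. -/
theorem IsConvexQuad.le_eLpNorm_comp (hp : IsConvexQuad p) (g : Plane → ℝ) :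
    eLpNorm g 2 (volume.restrict (openElement p)) ≤ ENNReal.ofReal (elementDiam p) *
      eLpNorm (fun x => g (bilinearMap p x)) 2 (volume.restrict (interior unitSquare)) := by
  rw [← ENNReal.pow_le_pow_left_iff (n := 2) (by norm_num), mul_pow, eLpNorm_two_sq,
    eLpNorm_two_sq, hp.setLIntegral_openElement, ← ENNReal.ofReal_pow (elementDiam_nonneg p),
    ← lintegral_const_mul' _ _ ENNReal.ofReal_ne_top]
  refine setLIntegral_mono' measurableSet_interior_unitSquare fun x hx => ?_
  gcongr
  exact abs_jac_le p (interior_subset hx)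

/-- Pulling back by the bilinear map respects equality almost everywhere. -/
theorem IsConvexQuad.quasiMeasurePreserving (hp : IsConvexQuad p) :
    Measure.QuasiMeasurePreserving (bilinearMap p) (volume.restrict (interior unitSquare))
      (volume.restrict (openElement p)) := by
  refine ⟨(contDiff_bilinearMap p).continuous.measurable, ?_⟩
  refine Measure.AbsolutelyContinuous.mk fun s hs h0 => ?_
  have hm := (contDiff_bilinearMap p).continuous.measurable
  rw [openElement, ← map_withDensity_abs_det_fderiv_eq_addHaar volume
    measurableSet_interior_unitSquare.nullMeasurableSet (hasFDerivWithinAt_bilinearMap p _)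
    hp.injOn_interior,
    Measure.map_apply hm hs] at h0
  rw [Measure.map_apply hm hs]
  refine withDensity_absolutelyContinuous' ?_ ?_ h0
  · simp only [det_fderiv_bilinearMap]
    exact (ENNReal.continuous_ofReal.comp (contDiff_jac p).continuous.abs).aemeasurable
  · refine ae_restrict_of_forall_mem measurableSet_interior_unitSquare fun x hx => ?_
    rw [det_fderiv_bilinearMap]
    simpa using hp.jac_ne_zero (interior_subset hx)

theorem IsConvexQuad.memLp_comp (hp : IsConvexQuad p) {g : Plane → ℝ}
    (hg : MemLp g 2 (volume.restrict (openElement p))) :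
    MemLp (fun x => g (bilinearMap p x)) 2 (volume.restrict (interior unitSquare)) := by
  refine ⟨hg.1.comp_quasiMeasurePreserving hp.quasiMeasurePreserving, ?_⟩
  obtain ⟨δ, hδ, h⟩ : ∃ δ : ℝ, 0 < δ ∧ ∀ x ∈ unitSquare, δ ^ 2 ≤ |jac p x| := by
    obtain ⟨δ, hδ, h⟩ := isCompact_unitSquare.exists_forall_le'
      (contDiff_jac p).continuous.abs.continuousOn (a := 0)
      fun x hx => abs_pos.2 (hp.jac_ne_zero hx)
    exact ⟨√δ, Real.sqrt_pos.2 hδ, fun x hx => by rw [Real.sq_sqrt hδ.le]; exact h x hx⟩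
  have := (hp.eLpNorm_comp_le hδ.le h g).trans_lt hg.2
  by_contra htop
  rw [not_lt, top_le_iff] at htop
  rw [htop, ENNReal.mul_top (by simpa using hδ)] at this
  exact this.ne rfl

end Convex

end QuadFE

/-! ### The chain rule for weak derivatives -/

namespace QuadFE

theorem partialDeriv_tangent_apply (p : Fin 4 → Plane) (l j i : Fin 2) :
    partialDeriv l (fun x => tangent p j x i) = fun _ => if l = j then 0 else twist p i := by
  ext x
  have h := (EuclideanSpace.proj (𝕜 := ℝ) i).hasFDerivAt.comp x (hasFDerivAt_tangent p j x)
  have e : partialDeriv l (fun x => tangent p j x i) x = partialDeriv l (tangent p j) x i := by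
    rw [partialDeriv, partialDeriv, (hasFDerivAt_tangent p j x).fderiv]
    exact congrArg (fun D => D (EuclideanSpace.single l (1 : ℝ))) h.fderiv
  rw [e, partialDeriv_tangent]
  split_ifs <;> simp

theorem partialDeriv_sub {f g : Plane → ℝ} (hf : ContDiff ℝ ∞ f) (hg : ContDiff ℝ ∞ g)
    (i : Fin 2) : partialDeriv i (f - g) = partialDeriv i f - partialDeriv i g := by
  ext x
  simp [partialDeriv, fderiv_sub (differentiable_of_contDiff hf x)
    (differentiable_of_contDiff hg x)]

theorem partialDeriv_jac (p : Fin 4 → Plane) (l : Fin 2) (x : Plane) :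
    partialDeriv l (jac p) x = if l = 0 then cross (tangent p 0 x) (twist p)
      else cross (twist p) (tangent p 1 x) := by
  have e : jac p = (fun x => tangent p 0 x 0) * (fun x => tangent p 1 x 1)
      - (fun x => tangent p 0 x 1) * fun x => tangent p 1 x 0 := rfl
  have h := contDiff_tangent_apply p
  have h0 : ContDiff ℝ ∞ ((fun x => tangent p 0 x 0) * fun x => tangent p 1 x 1) :=
    (h 0 0).mul (h 1 1)
  have h1 : ContDiff ℝ ∞ ((fun x => tangent p 0 x 1) * fun x => tangent p 1 x 0) :=
    (h 0 1).mul (h 1 0)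
  rw [e, partialDeriv_sub h0 h1, partialDeriv_mul (h 0 0) (h 1 1), partialDeriv_mul (h 0 1) (h 1 0)]
  simp only [partialDeriv_tangent_apply]
  fin_cases l <;> simp [cross]

/-- The classical chain rule for the composition with the bilinear map. -/
theorem partialDeriv_comp_bilinearMap {ψ : Plane → ℝ} (hψ : ContDiff ℝ ∞ ψ) (p : Fin 4 → Plane)
    (l : Fin 2) (x : Plane) :
    partialDeriv l (fun x => ψ (bilinearMap p x)) x
      = tangent p l x 0 * partialDeriv 0 ψ (bilinearMap p x)
        + tangent p l x 1 * partialDeriv 1 ψ (bilinearMap p x) := by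
  have h := ((differentiable_of_contDiff hψ) (bilinearMap p x)).hasFDerivAt.comp x
    (hasFDerivAt_bilinearMap p x)
  have e1 : partialDeriv l (fun x => ψ (bilinearMap p x)) x
      = fderiv ℝ ψ (bilinearMap p x) (tangent p l x) := by
    rw [partialDeriv]
    refine (congrArg (fun D => D (EuclideanSpace.single l (1 : ℝ))) h.fderiv).trans ?_
    have : bilinearDeriv p x (EuclideanSpace.single l (1 : ℝ)) = tangent p l x := by
      have := congrFun (partialDeriv_bilinearMap p l) x
      rwa [partialDeriv, (hasFDerivAt_bilinearMap p x).fderiv] at this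
    simp [this]
  have e2 : tangent p l x = tangent p l x 0 • EuclideanSpace.single 0 (1 : ℝ)
      + tangent p l x 1 • EuclideanSpace.single 1 (1 : ℝ) := by
    ext i; fin_cases i <;> simp
  rw [e1]
  conv_lhs => rw [e2]
  rw [map_add, map_smul, map_smul]
  rfl

variable {p : Fin 4 → Plane}

/-- Dividing a test function by the Jacobian determinant gives a test function. -/
theorem IsConvexQuad.exists_eq_jac_mul (hp : IsConvexQuad p) {φ : Plane → ℝ}
    (hφ : IsTest (interior unitSquare) φ) :
    ∃ ρ, IsTest (interior unitSquare) ρ ∧ φ = jac p * ρ := by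
  have h0 : ∀ x, x ∉ tsupport φ → φ x = 0 := fun x hx => image_eq_zero_of_notMem_tsupport hx
  have hs : tsupport (fun x => φ x / jac p x) ⊆ tsupport φ := by
    refine closure_minimal (fun x hx => ?_) (isClosed_tsupport _)
    by_contra h
    exact hx (by simp [h0 x h])
  refine ⟨fun x => φ x / jac p x, ⟨contDiff_iff_contDiffAt.2 fun x => ?_,
    hφ.2.isCompact.of_isClosed_subset (isClosed_tsupport _) hs, hs.trans hφ.3⟩, ?_⟩
  · by_cases hx : x ∈ tsupport φ
    · exact hφ.1.contDiffAt.div (contDiff_jac p).contDiffAt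
        (hp.jac_ne_zero (interior_subset (hφ.3 hx)))
    · refine (contDiffAt_const (c := (0 : ℝ))).congr_of_eventuallyEq ?_
      filter_upwards [(isClosed_tsupport φ).isOpen_compl.mem_nhds hx] with z hz
      simp [h0 z hz]
  · ext x
    by_cases hx : x ∈ tsupport φ
    · have := hp.jac_ne_zero (interior_subset (hφ.3 hx))
      simp only [Pi.mul_apply]
      field_simp
    · simp [h0 x hx]

/-- The Jacobian determinant has constant sign on the unit square. -/
theorem IsConvexQuad.exists_sign (hp : IsConvexQuad p) :
    ∃ s : ℝ, ∀ x ∈ unitSquare, |jac p x| = s * jac p x ∧ s * s = 1 := by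
  have key : ∀ c : Fin 4 → ℝ, (∀ i, 0 ≤ c i) → ∀ x ∈ unitSquare,
      0 ≤ (1 - x 0) * (1 - x 1) * c 3 + x 0 * (1 - x 1) * c 0 + x 0 * x 1 * c 1
        + (1 - x 0) * x 1 * c 2 := by
    intro c hc x hx
    have s0 := (hx 0).1
    have s1 := sub_nonneg.2 (hx 0).2
    have t0 := (hx 1).1
    have t1 := sub_nonneg.2 (hx 1).2
    have := hc 0; have := hc 1; have := hc 2; have := hc 3
    positivity
  rcases hp with hp | hp
  · refine ⟨1, fun x hx => ⟨?_, by norm_num⟩⟩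
    rw [one_mul, abs_of_nonneg, jac_eq]
    rw [jac_eq]
    exact key (fun i => cross (side p i) (side p (i + 1))) (fun i => (hp i).le) x hx
  · refine ⟨-1, fun x hx => ⟨?_, by norm_num⟩⟩
    rw [neg_one_mul, abs_of_nonpos]
    have := key (fun i => -cross (side p i) (side p (i + 1)))
      (fun i => neg_nonneg.2 (hp i).le) x hx
    rw [jac_eq]
    simp only [show (3 : Fin 4) + 1 = 0 from rfl, show (0 : Fin 4) + 1 = 1 from rfl,
      show (1 : Fin 4) + 1 = 2 from rfl, show (2 : Fin 4) + 1 = 3 from rfl] at this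
    linarith

/-- The chain rule for weak derivatives under the bilinear map. It is obtained by duality: the
Piola transform carries the test field `φ eⱼ` on the square to the test field `ψ` on the element
with `ψ ∘ F = φ ∂ⱼF / det DF`, and `(div ψ) ∘ F = ∂ⱼφ / det DF`. -/
theorem IsConvexQuad.weakPartial_comp (hp : IsConvexQuad p) {v g₀ g₁ : Plane → ℝ}
    (hv : MemLp v 2 (volume.restrict (openElement p)))
    (hg₀ : MemLp g₀ 2 (volume.restrict (openElement p)))
    (hg₁ : MemLp g₁ 2 (volume.restrict (openElement p)))
    (h₀ : WeakPartial (openElement p) 0 v g₀) (h₁ : WeakPartial (openElement p) 1 v g₁)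
    (j : Fin 2) :
    WeakPartial (interior unitSquare) j (fun x => v (bilinearMap p x))
      (fun x => g₀ (bilinearMap p x) * tangent p j x 0
        + g₁ (bilinearMap p x) * tangent p j x 1) := by
  intro φ hφ
  obtain ⟨ρ, hρ, hφρ⟩ := hp.exists_eq_jac_mul hφ
  obtain ⟨s, hs⟩ := hp.exists_sign
  have ht := contDiff_tangent_apply p
  have hχ : ∀ i, IsTest (interior unitSquare) ((fun x => tangent p j x i) * ρ) := fun i =>
    hρ.mul_left (ht j i)
  choose ψ hψ hψF using fun i => hp.exists_pushforward (hχ i)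
  -- the Piola transform commutes with the divergence
  have hdiv : ∀ x ∈ interior unitSquare, jac p x *
      (partialDeriv 0 (ψ 0) (bilinearMap p x) + partialDeriv 1 (ψ 1) (bilinearMap p x))
        = partialDeriv j φ x := by
    intro x hx
    have hJ := hp.jac_ne_zero (interior_subset hx)
    have hd : ∀ i l, tangent p l x 0 * partialDeriv 0 (ψ i) (bilinearMap p x)
        + tangent p l x 1 * partialDeriv 1 (ψ i) (bilinearMap p x)
        = tangent p j x i * partialDeriv l ρ x + (if l = j then 0 else twist p i) * ρ x := by
      intro i l
      rw [← partialDeriv_comp_bilinearMap (hψ i).1]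
      have hev : (fun x => ψ i (bilinearMap p x)) =ᶠ[nhds x] (fun x => tangent p j x i) * ρ :=
        Filter.eventually_of_mem (isOpen_interior.mem_nhds hx) (hψF i)
      rw [partialDeriv, hev.fderiv_eq]
      have := congrFun (partialDeriv_mul (ht j i) hρ.1 l) x
      rw [partialDeriv_tangent_apply] at this
      exact this
    have hφd : partialDeriv j φ x
        = jac p x * partialDeriv j ρ x + partialDeriv j (jac p) x * ρ x := by
      rw [hφρ, partialDeriv_mul (contDiff_jac p) hρ.1]
      rfl
    rw [hφd, partialDeriv_jac]
    have a00 := hd 0 0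
    have a01 := hd 0 1
    have a10 := hd 1 0
    have a11 := hd 1 1
    fin_cases j
    · simp [cross, jac] at a00 a01 a10 a11 ⊢
      linear_combination tangent p 1 x 1 * a00 - tangent p 0 x 1 * a01 + tangent p 0 x 0 * a11
        - tangent p 1 x 0 * a10
    · simp [cross, jac] at a00 a01 a10 a11 ⊢
      linear_combination tangent p 1 x 1 * a00 - tangent p 0 x 1 * a01 + tangent p 0 x 0 * a11
        - tangent p 1 x 0 * a10
  have e1 : ∫ x in interior unitSquare, v (bilinearMap p x) * partialDeriv j φ x
      = s * ∫ y in openElement p, v y * (partialDeriv 0 (ψ 0) y + partialDeriv 1 (ψ 1) y) := by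
    rw [hp.setIntegral_openElement, ← integral_const_mul]
    refine setIntegral_congr_fun measurableSet_interior_unitSquare fun x hx => ?_
    obtain ⟨hs1, hs2⟩ := hs x (interior_subset hx)
    rw [← hdiv x hx, hs1]
    linear_combination (-(v (bilinearMap p x) * (jac p x * (partialDeriv 0 (ψ 0) (bilinearMap p x)
      + partialDeriv 1 (ψ 1) (bilinearMap p x))))) * hs2
  have e2 : ∀ (g : Plane → ℝ) (i : Fin 2), s * ∫ y in openElement p, g y * ψ i y
      = ∫ x in interior unitSquare, g (bilinearMap p x) * tangent p j x i * φ x := by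
    intro g i
    rw [hp.setIntegral_openElement, ← integral_const_mul]
    refine setIntegral_congr_fun measurableSet_interior_unitSquare fun x hx => ?_
    obtain ⟨hs1, hs2⟩ := hs x (interior_subset hx)
    have hψx := hψF i x hx
    simp only [hψx, hs1, hφρ, Pi.mul_apply]
    linear_combination (g (bilinearMap p x) * tangent p j x i * jac p x * ρ x) * hs2
  have i1 : ∀ (g : Plane → ℝ) (i : Fin 2), MemLp g 2 (volume.restrict (openElement p)) →
      Integrable (fun x => g (bilinearMap p x) * tangent p j x i * φ x)
        (volume.restrict (interior unitSquare)) := by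
    intro g i hg
    have := (hφ.mul_left (ht j i)).integrable_mul (hp.memLp_comp hg)
    simpa [mul_assoc] using this
  simp_rw [mul_add] at e1
  rw [integral_add (((hψ 0).partialDeriv 0).integrable_mul hv)
    (((hψ 1).partialDeriv 1).integrable_mul hv), h₀ _ (hψ 0), h₁ _ (hψ 1), ← neg_add, mul_neg,
    mul_add, e2, e2, ← integral_add (i1 _ _ hg₀) (i1 _ _ hg₁)] at e1
  rw [e1]
  simp_rw [add_mul]

/-- The product rule with a smooth factor. -/
theorem WeakPartial.mul_contDiff {U : Set Plane} {i : Fin 2} {v g P : Plane → ℝ}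
    (h : WeakPartial U i v g) (hP : ContDiff ℝ ∞ P) (hv : MemLp v 2 (volume.restrict U))
    (hg : MemLp g 2 (volume.restrict U)) :
    WeakPartial U i (fun x => v x * P x) (fun x => g x * P x + v x * partialDeriv i P x) := by
  intro φ hφ
  have h1 := h _ (hφ.mul_left hP)
  rw [partialDeriv_mul hP hφ.1] at h1
  have i1 := ((hφ.partialDeriv i).mul_left hP).integrable_mul hv
  have i2 := (hφ.mul_left (contDiff_partialDeriv hP i)).integrable_mul hv
  have i3 := (hφ.mul_left hP).integrable_mul hg
  simp only [Pi.add_apply, Pi.mul_apply, mul_add] at h1 i1 i2 i3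
  rw [integral_add i1 i2] at h1
  simp_rw [add_mul, mul_assoc]
  rw [integral_add i3 i2, neg_add, ← h1]
  ring

/-- `P` is smooth, and on the unit square its derivatives of order `l ≤ d` are at most
`L h ^ (n + l)`. -/
def CoeffBound (h : ℝ) : ℕ → ℝ → ℕ → (Plane → ℝ) → Prop
  | 0, L, n, P => ContDiff ℝ ∞ P ∧ ∀ x ∈ unitSquare, |P x| ≤ L * h ^ n
  | d + 1, L, n, P => (ContDiff ℝ ∞ P ∧ ∀ x ∈ unitSquare, |P x| ≤ L * h ^ n) ∧
      ∀ j, CoeffBound h d L (n + 1) (partialDeriv j P)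

namespace CoeffBound

variable {h L L' : ℝ} {d n n' : ℕ} {P P' : Plane → ℝ}

theorem left (hP : CoeffBound h d L n P) :
    ContDiff ℝ ∞ P ∧ ∀ x ∈ unitSquare, |P x| ≤ L * h ^ n := by
  cases d
  exacts [hP, hP.1]

theorem of_succ (hP : CoeffBound h (d + 1) L n P) : CoeffBound h d L n P := by
  induction d generalizing n P with
  | zero => exact hP.1
  | succ d ih => exact ⟨hP.1, fun j => ih (hP.2 j)⟩

theorem add (hP : CoeffBound h d L n P) (hP' : CoeffBound h d L' n P') :
    CoeffBound h d (L + L') n (P + P') := by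
  have key : ∀ x ∈ unitSquare, |(P + P') x| ≤ (L + L') * h ^ n := fun x hx => by
    rw [add_mul]
    exact (abs_add_le _ _).trans (add_le_add (hP.left.2 x hx) (hP'.left.2 x hx))
  induction d generalizing n P P' with
  | zero => exact ⟨hP.1.add hP'.1, key⟩
  | succ d ih =>
    refine ⟨⟨hP.left.1.add hP'.left.1, key⟩, fun j => ?_⟩
    rw [partialDeriv_add hP.left.1 hP'.left.1]
    refine ih (hP.2 j) (hP'.2 j) fun x hx => ?_
    rw [add_mul]
    exact (abs_add_le _ _).trans (add_le_add ((hP.2 j).left.2 x hx) ((hP'.2 j).left.2 x hx))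

theorem mul (hP : CoeffBound h d L n P) (hP' : CoeffBound h d L' n' P') (hh : 0 ≤ h) (hL : 0 ≤ L)
    (hL' : 0 ≤ L') : CoeffBound h d (2 ^ d * (L * L')) (n + n') (P * P') := by
  have key : ∀ d' : ℕ, ∀ x ∈ unitSquare, |(P * P') x| ≤ 2 ^ d' * (L * L') * h ^ (n + n') := by
    intro d' x hx
    rw [Pi.mul_apply, abs_mul]
    refine (mul_le_mul (hP.left.2 x hx) (hP'.left.2 x hx) (abs_nonneg _) (by positivity)).trans ?_
    have : (1 : ℝ) ≤ 2 ^ d' := one_le_pow₀ (by norm_num)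
    calc L * h ^ n * (L' * h ^ n') = 1 * (L * L') * h ^ (n + n') := by ring
      _ ≤ _ := by gcongr
  induction d generalizing n n' P P' with
  | zero => exact ⟨hP.1.mul hP'.1, key 0⟩
  | succ d ih =>
    refine ⟨⟨hP.left.1.mul hP'.left.1, key _⟩, fun j => ?_⟩
    rw [partialDeriv_mul hP.left.1 hP'.left.1]
    have key' : ∀ {R R' : Plane → ℝ} {m m' : ℕ}, CoeffBound h d L m R → CoeffBound h d L' m' R' →
        CoeffBound h d (2 ^ d * (L * L')) (m + m') (R * R') := by
      intro R R' m m' hR hR'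
      refine ih hR hR' fun d' x hx => ?_
      rw [Pi.mul_apply, abs_mul]
      refine (mul_le_mul (hR.left.2 x hx) (hR'.left.2 x hx) (abs_nonneg _)
        (by positivity)).trans ?_
      have : (1 : ℝ) ≤ 2 ^ d' := one_le_pow₀ (by norm_num)
      calc L * h ^ m * (L' * h ^ m') = 1 * (L * L') * h ^ (m + m') := by ring
        _ ≤ _ := by gcongr
    have a := key' hP.of_succ (hP'.2 j)
    have b := key' (hP.2 j) hP'.of_succ
    rw [add_right_comm n 1 n'] at b
    have := a.add b
    rwa [show (2 : ℝ) ^ d * (L * L') + 2 ^ d * (L * L') = 2 ^ (d + 1) * (L * L') by ring] at this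

theorem const {c : ℝ} (hc : |c| ≤ L * h ^ n) (hh : 0 ≤ h) (hL : 0 ≤ L) :
    CoeffBound h d L n fun _ => c := by
  induction d generalizing n c with
  | zero => exact ⟨contDiff_const, fun _ _ => hc⟩
  | succ d ih =>
    refine ⟨⟨contDiff_const, fun _ _ => hc⟩, fun j => ?_⟩
    have : partialDeriv j (fun _ : Plane => c) = fun _ => 0 := by ext x; simp [partialDeriv]
    rw [this]
    exact ih (by rw [abs_zero]; positivity)

end CoeffBound

/-- The first derivatives of the bilinear map have order `h`, and its second derivatives have
order `h ^ 2` if the twist has. -/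
theorem coeffBound_tangent (p : Fin 4 → Plane) {L : ℝ} (hL : 1 ≤ L)
    (ht : ‖twist p‖ ≤ L * elementDiam p ^ 2) (d : ℕ) (j i : Fin 2) :
    CoeffBound (elementDiam p) d L 1 fun x => tangent p j x i := by
  have hh := elementDiam_nonneg p
  have key : ∀ x ∈ unitSquare, |tangent p j x i| ≤ L * elementDiam p ^ 1 := by
    intro x hx
    rw [pow_one]
    refine ((PiLp.norm_apply_le _ i).trans (norm_tangent_le p j hx)).trans ?_
    exact le_mul_of_one_le_left hh hL
  cases d with
  | zero => exact ⟨contDiff_tangent_apply p j i, key⟩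
  | succ d =>
    refine ⟨⟨contDiff_tangent_apply p j i, key⟩, fun l => ?_⟩
    rw [partialDeriv_tangent_apply]
    refine CoeffBound.const ?_ hh (zero_le_one.trans hL)
    split_ifs
    · rw [abs_zero]; positivity
    · exact (PiLp.norm_apply_le _ i).trans ht

theorem memLp_mul_of_bound {f P : Plane → ℝ} {K : ℝ}
    (hf : MemLp f 2 (volume.restrict (interior unitSquare))) (hP : Continuous P)
    (h : ∀ x ∈ unitSquare, |P x| ≤ K) :
    MemLp (fun x => f x * P x) 2 (volume.restrict (interior unitSquare)) ∧
      eLpNorm (fun x => f x * P x) 2 (volume.restrict (interior unitSquare))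
        ≤ ENNReal.ofReal K * eLpNorm f 2 (volume.restrict (interior unitSquare)) := by
  have hb : ∀ᵐ x ∂(volume.restrict (interior unitSquare)), ‖f x * P x‖ ≤ K * ‖f x‖ := by
    refine ae_restrict_of_forall_mem measurableSet_interior_unitSquare fun x hx => ?_
    rw [norm_mul, mul_comm]
    exact mul_le_mul_of_nonneg_right (h x (interior_subset hx)) (norm_nonneg _)
  exact ⟨hf.of_le_mul (hf.1.mul hP.aestronglyMeasurable) hb,
    eLpNorm_le_mul_eLpNorm_of_ae_le_mul hb 2⟩

/-- The constants of the iterated chain rule: the derivative of `(v ∘ F) P` is the sum of two terms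
`(∂ᵢv ∘ F) (∂ⱼF)ᵢ P`, whose new coefficients are bounded through `CoeffBound.mul`, and of
`(v ∘ F) ∂ⱼP`. -/
def chainConst (L : ℝ) : ℕ → ℝ
  | 0 => 1
  | k + 1 => chainConst L k * (2 ^ (k + 1) * L + 1)

theorem one_le_chainConst {L : ℝ} (hL : 1 ≤ L) (k : ℕ) : 1 ≤ chainConst L k := by
  induction k with
  | zero => exact le_rfl
  | succ k ih =>
    have : (0 : ℝ) ≤ 2 ^ (k + 1) * L := by positivity
    exact one_le_mul_of_one_le_of_one_le ih (by linarith)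

/-- Pullback by the bilinear map, multiplied by a coefficient of order `h ^ n`: the derivatives
of order `l` have order `h ^ (n + l)`. The coefficient makes the statement stable under
differentiation; since `A` bounds the derivatives of `v` of every order, no power of `h` is lost
where a derivative falls on the coefficient instead of on `v`. -/
theorem IsConvexQuad.weakBound_pullback (hp : IsConvexQuad p) {L δ : ℝ} (hL : 1 ≤ L)
    (ht : ‖twist p‖ ≤ L * elementDiam p ^ 2) (hδ : 0 < δ)
    (hJ : ∀ x ∈ unitSquare, δ ^ 2 ≤ |jac p x|) (A : ℝ≥0∞) (k : ℕ) :
    ∀ {v P : Plane → ℝ} {K : ℝ} {n : ℕ}, WeakBound k (openElement p) v (fun _ => A) → 0 ≤ K →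
      CoeffBound (elementDiam p) k K n P →
      WeakBound k (interior unitSquare) (fun x => v (bilinearMap p x) * P x)
        (fun l => ENNReal.ofReal (chainConst L k * K * elementDiam p ^ (n + l) * δ⁻¹) * A) := by
  have hh := elementDiam_nonneg p
  have base : ∀ {v P : Plane → ℝ} {K C : ℝ} {n : ℕ}, 1 ≤ C → 0 ≤ K →
      MemLp v 2 (volume.restrict (openElement p)) →
      eLpNorm v 2 (volume.restrict (openElement p)) ≤ A → CoeffBound (elementDiam p) 0 K n P →
      MemLp (fun x => v (bilinearMap p x) * P x) 2 (volume.restrict (interior unitSquare)) ∧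
      eLpNorm (fun x => v (bilinearMap p x) * P x) 2 (volume.restrict (interior unitSquare))
        ≤ ENNReal.ofReal (C * K * elementDiam p ^ (n + 0) * δ⁻¹) * A := by
    intro v P K C n hC hK hv hvA hP
    obtain ⟨m1, m2⟩ := memLp_mul_of_bound (hp.memLp_comp hv) hP.1.continuous hP.2
    refine ⟨m1, m2.trans ?_⟩
    have h1 : eLpNorm (fun x => v (bilinearMap p x)) 2 (volume.restrict (interior unitSquare))
        ≤ ENNReal.ofReal δ⁻¹ * A := by
      have := (hp.eLpNorm_comp_le hδ.le hJ v).trans hvA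
      rw [ENNReal.ofReal_inv_of_pos hδ, mul_comm, ← div_eq_mul_inv,
        ENNReal.le_div_iff_mul_le (by simp [hδ]) (by simp), mul_comm]
      exact this
    refine (mul_le_mul_right h1 _).trans ?_
    rw [← mul_assoc, ← ENNReal.ofReal_mul (by positivity)]
    rw [add_zero]
    gcongr
    exact le_mul_of_one_le_left hK hC
  induction k with
  | zero =>
    intro v P K n hv hK hP
    exact base le_rfl hK hv.1 hv.2 hP
  | succ k ih =>
    intro v P K n hv hK hP
    refine ⟨base (one_le_chainConst hL _) hK hv.memLp hv.eLpNorm_le hP.left, fun j => ?_⟩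
    obtain ⟨g₀, h₀, hg₀⟩ := hv.2 0
    obtain ⟨g₁, h₁, hg₁⟩ := hv.2 1
    have hw := hp.weakPartial_comp hv.memLp hg₀.memLp hg₁.memLp h₀ h₁ j
    have hT := fun i => coeffBound_tangent p hL ht k j i
    have c : ∀ i, CoeffBound (elementDiam p) k (2 ^ k * (L * K)) (1 + n)
        ((fun x => tangent p j x i) * P) := fun i =>
      (hT i).mul hP.of_succ hh (by linarith) hK
    have hK' : 0 ≤ 2 ^ k * (L * K) := by positivity
    have b0 := ih hg₀ hK' (c 0)
    have b1 := ih hg₁ hK' (c 1)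
    have b2 := ih hv.of_succ hK (hP.2 j)
    refine ⟨_, hw.mul_contDiff hP.left.1 (hp.memLp_comp hv.memLp) ?_, ?_⟩
    · exact (memLp_mul_of_bound (hp.memLp_comp hg₀.memLp) (hT 0).left.1.continuous
        (hT 0).left.2).1.add (memLp_mul_of_bound (hp.memLp_comp hg₁.memLp)
        (hT 1).left.1.continuous (hT 1).left.2).1
    · have := (b0.add b1).add b2
      convert this.mono_bound (B := fun l => ENNReal.ofReal
        (chainConst L (k + 1) * K * elementDiam p ^ (n + (l + 1)) * δ⁻¹) * A) ?_ using 1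
      · ext x
        simp
        ring
      · intro l _
        have hc := one_le_chainConst hL k
        simp only [Pi.add_apply]
        rw [← add_mul, ← add_mul, ← ENNReal.ofReal_add (by positivity) (by positivity),
          ← ENNReal.ofReal_add (by positivity) (by positivity)]
        gcongr
        rw [chainConst]
        refine le_of_eq ?_
        rw [show n + (l + 1) = n + 1 + l by ring, show 1 + n + l = n + 1 + l by ring]
        ring

end QuadFE

/-! ### Existence of reference operators -/

namespace QuadFE

/-- A polynomial is determined by its values almost everywhere on the unit square. -/
theorem eq_zero_of_polyFun_ae_eq_zero {q : MvPolynomial (Fin 2) ℝ}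
    (h : polyFun q =ᵐ[volume.restrict (interior unitSquare)] 0) : q = 0 := by
  have h0 : Set.EqOn (polyFun q) 0 (interior unitSquare) :=
    Measure.eqOn_open_of_ae_eq h isOpen_interior (contDiff_polyFun q).continuous.continuousOn
      continuousOn_const
  refine MvPolynomial.funext_set (fun _ => Set.Ioo (0 : ℝ) 1)
    (fun _ => Set.Ioo_infinite zero_lt_one) fun x hx => ?_
  have := h0 (x := WithLp.toLp 2 x) (by rw [interior_unitSquare]; exact fun i => hx i trivial)
  simpa [polyFun] using this

/-- Polynomials in `V` as elements of `L²` of the unit square. -/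
noncomputable def polyToLp (V : Submodule ℝ (MvPolynomial (Fin 2) ℝ)) :
    V →ₗ[ℝ] Lp ℝ 2 ((volume : Measure Plane).restrict (interior unitSquare)) where
  toFun q := (memLp_polyFun q.1).toLp
  map_add' q q' := by
    rw [← MemLp.toLp_add]
    exact MemLp.toLp_congr _ _ (by rw [Submodule.coe_add, polyFun_add])
  map_smul' c q := by
    rw [RingHom.id_apply, ← MemLp.toLp_const_smul]
    exact MemLp.toLp_congr _ _ (by rw [Submodule.coe_smul, polyFun_smul])

theorem polyToLp_injective (V : Submodule ℝ (MvPolynomial (Fin 2) ℝ)) :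
    Function.Injective (polyToLp V) := by
  rw [injective_iff_map_eq_zero]
  intro q hq
  refine Subtype.ext (eq_zero_of_polyFun_ae_eq_zero ?_)
  exact (MemLp.coeFn_toLp (memLp_polyFun q.1)).symm.trans ((Lp.eq_zero_iff_ae_eq_zero).1 hq)

/-- The `L²` projection onto `V`, as a linear map on `L²` of the unit square. -/
noncomputable def lpProjection (V : Submodule ℝ (MvPolynomial (Fin 2) ℝ)) [FiniteDimensional ℝ V] :
    Lp ℝ 2 ((volume : Measure Plane).restrict (interior unitSquare)) →ₗ[ℝ] V :=
  (LinearEquiv.ofInjective (polyToLp V) (polyToLp_injective V)).symm.toLinearMap ∘ₗ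
    (LinearMap.range (polyToLp V)).orthogonalProjectionOnto.toLinearMap

theorem norm_polyToLp_lpProjection_le (V : Submodule ℝ (MvPolynomial (Fin 2) ℝ))
    [FiniteDimensional ℝ V] (F : Lp ℝ 2 ((volume : Measure Plane).restrict (interior unitSquare))) :
    ‖polyToLp V (lpProjection V F)‖ ≤ ‖F‖ := by
  have h : polyToLp V (lpProjection V F)
      = (LinearMap.range (polyToLp V)).orthogonalProjectionOnto F :=
    congrArg Subtype.val ((LinearEquiv.ofInjective (polyToLp V)
      (polyToLp_injective V)).apply_symm_apply _)
  rw [h]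
  exact Submodule.norm_orthogonalProjectionOnto_apply_le (LinearMap.range (polyToLp V)) F

theorem lpProjection_polyToLp (V : Submodule ℝ (MvPolynomial (Fin 2) ℝ)) [FiniteDimensional ℝ V]
    (q : V) : lpProjection V (polyToLp V q) = q := by
  have h := Submodule.orthogonalProjectionOnto_mem_subspace_eq_self
    (K := LinearMap.range (polyToLp V)) ⟨polyToLp V q, LinearMap.mem_range_self _ q⟩
  refine (congrArg (LinearEquiv.ofInjective (polyToLp V) (polyToLp_injective V)).symm h).trans ?_
  exact (LinearEquiv.ofInjective (polyToLp V) (polyToLp_injective V)).symm_apply_apply q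

open Classical in
/-- The `L²` projection onto the polynomials in `V`, extended by zero to functions that are not
square integrable. -/
noncomputable def l2Projection (V : Submodule ℝ (MvPolynomial (Fin 2) ℝ)) [FiniteDimensional ℝ V]
    (w : Plane → ℝ) : MvPolynomial (Fin 2) ℝ :=
  if h : MemLp w 2 (volume.restrict (interior unitSquare)) then lpProjection V (h.toLp w) else 0

theorem l2Projection_eq (V : Submodule ℝ (MvPolynomial (Fin 2) ℝ)) [FiniteDimensional ℝ V]
    {w : Plane → ℝ} (h : MemLp w 2 (volume.restrict (interior unitSquare))) :
    l2Projection V w = lpProjection V (h.toLp w) := by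
  rw [l2Projection, dif_pos h]

theorem isReferenceOperator_l2Projection (r : ℕ) (V : Submodule ℝ (MvPolynomial (Fin 2) ℝ))
    [FiniteDimensional ℝ V] (hV : MvPolynomial.restrictTotalDegree (Fin 2) ℝ r ≤ V) :
    IsReferenceOperator r V (l2Projection V) where
  mem w hw := by
    rw [l2Projection_eq V hw.1]
    exact Subtype.coe_prop _
  map_add w w' hw hw' := by
    rw [l2Projection_eq V hw.1, l2Projection_eq V hw'.1, l2Projection_eq V (hw.1.add hw'.1),
      MemLp.toLp_add hw.1 hw'.1, map_add, Submodule.coe_add]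
  map_smul c w hw := by
    rw [l2Projection_eq V hw.1, l2Projection_eq V (hw.1.const_smul c),
      MemLp.toLp_const_smul c hw.1, map_smul, Submodule.coe_smul]
  bounded := by
    refine ⟨1, fun w hw => ?_⟩
    rw [ENNReal.ofReal_one, one_mul, ← restrict_interior_unitSquare]
    refine le_trans ?_ (hw.eLpNorm_le isOpen_interior)
    rw [l2Projection_eq V hw.1]
    have h := norm_polyToLp_lpProjection_le V (hw.1.toLp w)
    have e : ‖polyToLp V (lpProjection V (hw.1.toLp w))‖ = _ :=
      Lp.norm_toLp _ (memLp_polyFun (lpProjection V (hw.1.toLp w)).1)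
    rw [e, Lp.norm_toLp] at h
    exact (ENNReal.toReal_le_toReal (memLp_polyFun _).2.ne hw.1.2.ne).1 h
  reproduces q hq := by
    rw [l2Projection_eq V (memLp_polyFun q)]
    exact congrArg Subtype.val (lpProjection_polyToLp V ⟨q, hV hq⟩)

end QuadFE

/-! ### Error estimates on elements and meshes -/

namespace QuadFE

theorem memSobolev_polyFun (m : ℕ) (q : MvPolynomial (Fin 2) ℝ) :
    MemSobolev m (interior unitSquare) (polyFun q) :=
  ⟨memLp_polyFun q, fun α _ => ⟨_, memLp_polyFun _, hasWeakDeriv_polyFun _ q α.1 α.2⟩⟩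

/-- On the unit square, the error of a reference operator at `w` is that at `w - q` for every
polynomial `q` of degree at most `r`, hence is controlled by the norm of `w - q`. -/
theorem IsReferenceOperator.eLpNorm_sub_le {r : ℕ} {V : Submodule ℝ (MvPolynomial (Fin 2) ℝ)}
    {T : (Plane → ℝ) → MvPolynomial (Fin 2) ℝ} (hT : IsReferenceOperator r V T) {B : ℝ}
    (hB : ∀ w, MemSobolev (r + 1) (interior unitSquare) w →
      eLpNorm (polyFun (T w)) 2 (volume.restrict unitSquare)
        ≤ ENNReal.ofReal B * sobolevNorm (r + 1) (interior unitSquare) w)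
    {w : Plane → ℝ} {q : MvPolynomial (Fin 2) ℝ} (hq : q.totalDegree ≤ r)
    (hw : MemSobolev (r + 1) (interior unitSquare) (w - polyFun q)) :
    eLpNorm (w - polyFun (T w)) 2 (volume.restrict (interior unitSquare))
      ≤ (1 + ENNReal.ofReal B) * sobolevNorm (r + 1) (interior unitSquare) (w - polyFun q) := by
  have hTw : T w = T (w - polyFun q) + q := by
    conv_lhs => rw [← sub_add_cancel w (polyFun q)]
    rw [hT.map_add _ _ hw (memSobolev_polyFun _ q), hT.reproduces q
      ((MvPolynomial.mem_restrictTotalDegree _ _ _).2 hq)]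
  have e : w - polyFun (T w) = (w - polyFun q) - polyFun (T (w - polyFun q)) := by
    rw [hTw, polyFun_add]; abel
  have h := hB _ hw
  rw [← restrict_interior_unitSquare] at h
  rw [e, add_mul, one_mul]
  exact (MeasureTheory.eLpNorm_sub_le hw.1.1 (memLp_polyFun _).1 (by norm_num)).trans
    (add_le_add (hw.eLpNorm_le isOpen_interior) h)

variable {p : Fin 4 → Plane}

theorem IsConvexQuad.elementOperator_apply (hp : IsConvexQuad p)
    (T : (Plane → ℝ) → MvPolynomial (Fin 2) ℝ) (v : Plane → ℝ) {x : Plane} (hx : x ∈ unitSquare) :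
    elementOperator T p v (bilinearMap p x) = polyFun (T fun x => v (bilinearMap p x)) x := by
  rw [elementOperator, hp.injOn.leftInvOn_invFunOn hx]

/-- The pullback of a Sobolev function: its derivatives of order `l` are of order `h ^ l`, up to
the factor `δ⁻¹` from the change of variables. -/
theorem IsConvexQuad.weakBound_comp (hp : IsConvexQuad p) {L δ : ℝ} (hL : 1 ≤ L)
    (ht : ‖twist p‖ ≤ L * elementDiam p ^ 2) (hδ : 0 < δ)
    (hJ : ∀ x ∈ unitSquare, δ ^ 2 ≤ |jac p x|) {m : ℕ} {v : Plane → ℝ}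
    (hv : MemSobolev m (interior (element p)) v) :
    WeakBound m (interior unitSquare) (fun x => v (bilinearMap p x)) fun l =>
      ENNReal.ofReal (chainConst L m * elementDiam p ^ l * δ⁻¹)
        * sobolevNorm m (interior (element p)) v := by
  have h1 := (hv.weakBound isOpen_interior).mono_set hp.openElement_subset
  have h2 := hp.weakBound_pullback hL ht hδ hJ _ m h1 zero_le_one
    (CoeffBound.const (c := 1) (n := 0) (by simp) (elementDiam_nonneg p) zero_le_one)
  simpa using h2

/-- The element estimate with explicit constants: the pullback gains `h ^ (r + 1)` from the chain
rule, and the powers of `h` from the two changes of variables cancel. -/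
theorem IsReferenceOperator.exists_element_estimate {r : ℕ}
    {V : Submodule ℝ (MvPolynomial (Fin 2) ℝ)} {T : (Plane → ℝ) → MvPolynomial (Fin 2) ℝ}
    (hT : IsReferenceOperator r V T) (κ γ M : ℝ) (hγ : γ < 1) :
    ∃ C : ℝ, 0 ≤ C ∧ ∀ p : Fin 4 → Plane, IsConvexQuad p → ShapeRegular κ γ p →
      sigma p ≤ M * elementDiam p → ∀ v : Plane → ℝ, MemSobolev (r + 1) (interior (element p)) v →
        MemSobolev (r + 1) (interior unitSquare) (fun x => v (bilinearMap p x)) ∧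
        eLpNorm (v - elementOperator T p v) 2 (volume.restrict (openElement p))
          ≤ ENNReal.ofReal (C * elementDiam p ^ (r + 1))
            * sobolevNorm (r + 1) (interior (element p)) v := by
  obtain ⟨B, hB⟩ := hT.bounded
  obtain ⟨CB, hCB⟩ := bramble_hilbert r
  set L := max 1 (2 * M / √(1 - γ ^ 2)) with hL
  set c := √(√(1 - γ ^ 2) / κ ^ 2) with hc
  have hL1 : 1 ≤ L := le_max_left _ _
  have hch : 0 ≤ chainConst L (r + 1) := zero_le_one.trans (one_le_chainConst hL1 _)
  have hc0 : 0 ≤ c := Real.sqrt_nonneg _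
  refine ⟨(1 + max B 0) * CB * chainConst L (r + 1) * c⁻¹, by positivity,
    fun p hp hs hM v hv => ?_⟩
  have hh := hp.elementDiam_pos
  have hγ0 : 0 ≤ γ := (abs_nonneg _).trans (hs 0).2
  have hκ : 0 < κ := by
    by_contra hκ
    nlinarith [(hs 0).1, norm_nonneg (side p 0)]
  have hγ2 : 0 < √(1 - γ ^ 2) := Real.sqrt_pos.2 (by nlinarith)
  have hcpos : 0 < c := Real.sqrt_pos.2 (by positivity)
  have ht : ‖twist p‖ ≤ L * elementDiam p ^ 2 :=
    (norm_twist_le hγ hp hs hM).trans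
      (mul_le_mul_of_nonneg_right (le_max_right _ _) (by positivity))
  have hJ : ∀ x ∈ unitSquare, (c * elementDiam p) ^ 2 ≤ |jac p x| := fun x hx => by
    rw [mul_pow, hc, Real.sq_sqrt (by positivity)]
    exact hs.le_abs_jac hp hx
  have hwb := hp.weakBound_comp hL1 ht (mul_pos hcpos hh) hJ hv
  refine ⟨hwb.memSobolev, ?_⟩
  obtain ⟨q, hq, hz, hzn⟩ := hCB _ _ hwb
  have hmain := (hT.eLpNorm_sub_le hB hq hz).trans (mul_le_mul_right hzn _)
  refine (hp.le_eLpNorm_comp _).trans ?_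
  have e : eLpNorm (fun x => (v - elementOperator T p v) (bilinearMap p x)) 2
      (volume.restrict (interior unitSquare))
      = eLpNorm ((fun x => v (bilinearMap p x)) - polyFun (T fun x => v (bilinearMap p x))) 2
        (volume.restrict (interior unitSquare)) := by
    refine eLpNorm_congr_ae
      (ae_restrict_of_forall_mem measurableSet_interior_unitSquare fun x hx => ?_)
    simp only [Pi.sub_apply]
    rw [hp.elementOperator_apply T v (interior_subset hx)]
  rw [e]
  refine (mul_le_mul_right hmain _).trans_eq ?_
  have hB' : (1 : ℝ≥0∞) + ENNReal.ofReal B = ENNReal.ofReal (1 + max B 0) := by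
    rw [ENNReal.ofReal_add zero_le_one (le_max_right _ _), ENNReal.ofReal_one]
    congr 1
    rcases le_total B 0 with h | h
    · rw [max_eq_right h, ENNReal.ofReal_of_nonpos h, ENNReal.ofReal_zero]
    · rw [max_eq_left h]
  rw [hB', ← ENNReal.ofReal_coe_nnreal, ← mul_assoc, ← mul_assoc, ← mul_assoc,
    ← ENNReal.ofReal_mul (by positivity), ← ENNReal.ofReal_mul (by positivity),
    ← ENNReal.ofReal_mul (by positivity)]
  congr 2
  field_simp

theorem HasWeakDeriv.mono {U W : Set Plane} {α : ℕ × ℕ} {v g : Plane → ℝ}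
    (h : HasWeakDeriv W α v g) (hUW : U ⊆ W) : HasWeakDeriv U α v g := by
  rw [hasWeakDeriv_iff] at h ⊢
  intro φ hφ
  have := h φ (hφ.mono hUW)
  rwa [(hφ.mono hUW).setIntegral_mul, ((hφ.mono hUW).multiDeriv α).setIntegral_mul,
    ← hφ.setIntegral_mul, ← (hφ.multiDeriv α).setIntegral_mul] at this

theorem MemSobolev.mono {m : ℕ} {U W : Set Plane} {v : Plane → ℝ} (h : MemSobolev m W v)
    (hUW : U ⊆ W) : MemSobolev m U v := by
  have hr := Measure.restrict_mono_set volume hUW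
  refine ⟨h.1.mono_measure hr, fun α hα => ?_⟩
  obtain ⟨g, hg, hg'⟩ := h.2 α hα
  exact ⟨g, hg.mono_measure hr, hg'.mono hUW⟩

theorem sobolevNorm_sq (m : ℕ) (U : Set Plane) (v : Plane → ℝ) :
    sobolevNorm m U v ^ 2 = ∑ k ∈ Finset.range (m + 1),
      ∑ α ∈ Finset.HasAntidiagonal.antidiagonal k,
        eLpNorm (weakDeriv U α v) 2 (volume.restrict U) ^ 2 := by
  rw [sobolevNorm, ← ENNReal.rpow_natCast, ← ENNReal.rpow_mul, Nat.cast_ofNat,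
    show (1 / 2 : ℝ) * 2 = 1 by norm_num, ENNReal.rpow_one]

/-- The squared Sobolev norm is superadditive over disjoint open subsets. -/
theorem MemSobolev.sum_sobolevNorm_sq_le {m : ℕ} {W : Set Plane} {v : Plane → ℝ}
    (h : MemSobolev m W v) {ι : Type*} (s : Finset ι) (U : ι → Set Plane)
    (hU : ∀ i ∈ s, IsOpen (U i)) (hUW : ∀ i ∈ s, U i ⊆ W)
    (hd : Set.PairwiseDisjoint (s : Set ι) U) :
    ∑ i ∈ s, sobolevNorm m (U i) v ^ 2 ≤ sobolevNorm m W v ^ 2 := by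
  simp only [sobolevNorm_sq]
  rw [Finset.sum_comm]
  refine Finset.sum_le_sum fun k hk => ?_
  rw [Finset.sum_comm]
  refine Finset.sum_le_sum fun α hα => ?_
  have hαm : α.1 + α.2 ≤ m := by
    have := Finset.HasAntidiagonal.mem_antidiagonal.1 hα
    have := Finset.mem_range.1 hk
    omega
  obtain ⟨h1, h2⟩ := h.weakDeriv_spec hαm
  have e : ∀ i ∈ s, eLpNorm (weakDeriv (U i) α v) 2 (volume.restrict (U i)) ^ 2
      = ∫⁻ x in U i, ‖weakDeriv W α v x‖ₑ ^ 2 := fun i hi => by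
    rw [(h2.mono (hUW i hi)).eLpNorm_weakDeriv (hU i hi)
      (h1.mono_measure (Measure.restrict_mono_set volume (hUW i hi))), eLpNorm_two_sq]
  rw [Finset.sum_congr rfl e, ← lintegral_biUnion_finset hd fun i hi => (hU i hi).measurableSet,
    eLpNorm_two_sq]
  exact lintegral_mono_set (Set.iUnion₂_subset hUW)

theorem QuadMesh.elementDiam_le_size (𝒯 : QuadMesh) {p : Fin 4 → Plane} (hp : p ∈ 𝒯.elements) :
    elementDiam p ≤ 𝒯.size :=
  le_ciSup (f := fun p : 𝒯.elements => elementDiam p.1) (Set.finite_range _).bddAbove ⟨p, hp⟩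

/-- The closed elements cover the domain, and their boundaries are null sets. -/
theorem QuadMesh.eLpNorm_sq_le (𝒯 : QuadMesh) (f : Plane → ℝ) :
    eLpNorm f 2 (volume.restrict 𝒯.domain) ^ 2
      ≤ ∑ p ∈ 𝒯.elements, eLpNorm f 2 (volume.restrict (openElement p)) ^ 2 := by
  simp only [eLpNorm_two_sq]
  have hsub : 𝒯.domain ⊆ ⋃ p : 𝒯.elements, element p.1 := by
    refine subset_closure.trans ?_
    rw [← 𝒯.cover, Set.iUnion_subtype]
  refine (lintegral_mono_set hsub).trans ((lintegral_iUnion_le _ _).trans_eq ?_)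
  rw [tsum_fintype, ← Finset.sum_coe_sort 𝒯.elements]
  simp only [restrict_openElement]

/-- The elementwise approximation on a mesh. It is defined through the disjoint open elements, so
that the values on shared edges, a null set, are irrelevant. -/
noncomputable def meshOperator (𝒯 : QuadMesh) (T : (Plane → ℝ) → MvPolynomial (Fin 2) ℝ)
    (u : Plane → ℝ) : Plane → ℝ :=
  ∑ p ∈ 𝒯.elements, (openElement p).indicator (elementOperator T p u)

theorem QuadMesh.meshOperator_eq (𝒯 : QuadMesh) (T : (Plane → ℝ) → MvPolynomial (Fin 2) ℝ)
    (u : Plane → ℝ) {p : Fin 4 → Plane} (hp : p ∈ 𝒯.elements) {y : Plane} (hy : y ∈ openElement p) :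
    meshOperator 𝒯 T u y = elementOperator T p u y := by
  rw [meshOperator, Finset.sum_apply, Finset.sum_eq_single_of_mem p hp fun q hq hqp => ?_,
    Set.indicator_of_mem hy]
  refine Set.indicator_of_notMem (fun hyq => ?_) _
  exact Set.disjoint_left.1 (𝒯.disjoint q hq p hp hqp) ((𝒯.convex q hq).openElement_subset hyq)
    ((𝒯.convex p hp).openElement_subset hy)

end QuadFE

theorem mainTheorem7 (r : ℕ) (V : Submodule ℝ (MvPolynomial (Fin 2) ℝ))
    [FiniteDimensional ℝ V] (hV : MvPolynomial.restrictTotalDegree (Fin 2) ℝ r ≤ V)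
    (κ γ M : ℝ) (hγ : γ < 1) :
    -- the second derivatives of the bilinear maps are of order `h_K ^ 2`
    (∃ C : ℝ, ∀ p : Fin 4 → Plane, IsConvexQuad p → ShapeRegular κ γ p →
      sigma p ≤ M * elementDiam p →
        w2infSeminorm (bilinearMap p) ≤ ENNReal.ofReal (C * elementDiam p ^ 2)) ∧
    -- reference operators exist, and each of them gives the element estimate
    (∃ T : (Plane → ℝ) → MvPolynomial (Fin 2) ℝ, IsReferenceOperator r V T) ∧
    (∀ T : (Plane → ℝ) → MvPolynomial (Fin 2) ℝ, IsReferenceOperator r V T →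
      ∃ C : ℝ, ∀ p : Fin 4 → Plane, IsConvexQuad p → ShapeRegular κ γ p →
        sigma p ≤ M * elementDiam p →
          ∀ v : Plane → ℝ, MemSobolev (r + 1) (interior (element p)) v →
            eLpNorm (v - elementOperator T p v) 2 (volume.restrict (element p))
              ≤ ENNReal.ofReal (C * elementDiam p ^ (r + 1))
                * sobolevNorm (r + 1) (interior (element p)) v) ∧
    -- best approximation on meshes converges with order `r + 1`
    (∃ C : ℝ, ∀ 𝒯 : QuadMesh,
      (∀ p ∈ 𝒯.elements, ShapeRegular κ γ p ∧ sigma p ≤ M * elementDiam p) →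
        ∀ u : Plane → ℝ, MemSobolev (r + 1) 𝒯.domain u →
          (⨅ w ∈ 𝒯.space V, eLpNorm (u - w) 2 (volume.restrict 𝒯.domain))
            ≤ ENNReal.ofReal (C * 𝒯.size ^ (r + 1)) * sobolevNorm (r + 1) 𝒯.domain u) := by
  refine ⟨⟨2 * M / √(1 - γ ^ 2), fun p hp hs hM => ?_⟩,
    ⟨l2Projection V, isReferenceOperator_l2Projection r V hV⟩, fun T hT => ?_, ?_⟩
  · refine (w2infSeminorm_bilinearMap_le p).trans ?_
    rw [← ofReal_norm]
    exact ENNReal.ofReal_le_ofReal (norm_twist_le hγ hp hs hM)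
  · obtain ⟨C, -, h⟩ := hT.exists_element_estimate κ γ M hγ
    refine ⟨C, fun p hp hs hM v hv => ?_⟩
    rw [← restrict_openElement]
    exact (h p hp hs hM v hv).2
  · have hT := isReferenceOperator_l2Projection r V hV
    obtain ⟨C, hC, h⟩ := hT.exists_element_estimate κ γ M hγ
    refine ⟨C, fun 𝒯 h𝒯 u hu => ?_⟩
    have hloc : ∀ p ∈ 𝒯.elements, MemSobolev (r + 1) (interior (element p)) u := fun p hp =>
      hu.mono (𝒯.interior_subset p hp)
    have hmem : meshOperator 𝒯 (l2Projection V) u ∈ 𝒯.space V := by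
      intro p hp
      have hpc := 𝒯.convex p hp
      have hw := (h p hpc (h𝒯 p hp).1 (h𝒯 p hp).2 u (hloc p hp)).1
      refine ⟨_, hT.mem _ hw, ?_⟩
      rw [← restrict_interior_unitSquare]
      refine ae_restrict_of_forall_mem measurableSet_interior_unitSquare fun x hx => ?_
      beta_reduce
      rw [𝒯.meshOperator_eq _ u hp (Set.mem_image_of_mem _ hx),
        hpc.elementOperator_apply _ u (interior_subset hx)]
    refine (iInf₂_le _ hmem).trans ?_
    rw [← ENNReal.pow_le_pow_left_iff (n := 2) (by norm_num), mul_pow]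
    refine (𝒯.eLpNorm_sq_le _).trans ?_
    refine le_trans ?_ (mul_le_mul_right (hu.sum_sobolevNorm_sq_le 𝒯.elements
      (fun p => interior (element p)) (fun _ _ => isOpen_interior)
      𝒯.interior_subset fun p hp q hq hpq => 𝒯.disjoint p hp q hq hpq) _)
    rw [Finset.mul_sum]
    refine Finset.sum_le_sum fun p hp => ?_
    have hpc := 𝒯.convex p hp
    have e : eLpNorm (u - meshOperator 𝒯 (l2Projection V) u) 2 (volume.restrict (openElement p))
        = eLpNorm (u - elementOperator (l2Projection V) p u) 2
          (volume.restrict (openElement p)) := by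
      refine eLpNorm_congr_ae
        (ae_restrict_of_forall_mem hpc.isOpen_openElement.measurableSet fun y hy => ?_)
      simp only [Pi.sub_apply]
      rw [𝒯.meshOperator_eq _ u hp hy]
    rw [e, ← mul_pow]
    gcongr
    refine ((h p hpc (h𝒯 p hp).1 (h𝒯 p hp).2 u (hloc p hp)).2).trans ?_
    have := elementDiam_nonneg p
    gcongr
    exact 𝒯.elementDiam_le_size hp
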